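/- **Setting.** Fix $d\ge 0$, a real $c>0$, and a Borel probability measure $\mathcal D$ on $\mathbb R^d$ with compact support $S$. An MRFG with $n$ roots is $\mathbb G=(G,\bar u,\chi)$ with $G$ a simple graph, $\bar u=(u_1,\dots,u_n)$ vertices of $G$ (not necessarily distinct) and $\chi:V(G)\to S$; graphs are finite, except that infinite locally finite ones occur through the branching process below. $N(v)$ is the set of neighbours of $v$; $\mathbb G[v]$ appends $v$ to the list of roots; $\mathbb G\sqcup\mathbb H$ is the disjoint union, with concatenated root lists; $B_r(v)$ is the featured subgraph induced on the vertices at distance at most $r$ from $v$, with single root $v$. A rooted featured tree is an MRFG with one root whose graph is a tree. **Terms.** Terms $\tau(u_1,\dots,u_n)$ are built from real constants, $\mathrm{val}_i(u_j)$ (the $i$-th feature), the indicators $\mathrm E(u_i,u_j)$ and $u_i=u_j$, by applying Lipschitz functions $F:\mathbb R^m\to\mathbb R$ and the aggregators $\mathrm{Mean}_v\pi$, $\mathrm{LMean}_{vEu_i}\pi$ and $\sup_v\pi$. Their values $[\![\tau]\!]_{\mathbb G}$ at an MRFG with $n$ roots are the obvious ones: $\mathrm{Mean}$ and $\sup$ are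 the average and the supremum of $[\![\pi]\!]_{\mathbb G[v]}$ over all $v\in V(G)$; $\mathrm{LMean}$ is the average over $v\in N(u_i)$, and $0$ if $u_i$ is isolated. The rank of $\tau$ is the nesting depth of aggregators. The slope is: $0$ for constants; $1$ for the other atoms; $\max_i \mathrm{slope}_F\,\mathrm{slope}_{\pi_i}$ for $F(\pi_1,\dots,\pi_m)$, where $\mathrm{slope}_F$ is the least Lipschitz constant of $F$ in the sup norm; $\mathrm{slope}_\pi+1$ for $\mathrm{Mean}_v\pi$ and $\mathrm{LMean}_{vEu_i}\pi$; $\mathrm{slope}_\pi$ for $\sup_v\pi$. **Branching process and controllers.** $\mathrm{FBP}$ is the random rooted featured tree in which numbers of children are Poisson with mean $c$ and features have law $\mathcal D$, all independent; $\mathrm{FBP}|_r$ consists of its generations $0,\dots,r$. The controller $\lambda_\tau(\mathbb G)$ is defined by the same recursion as $[\![\tau]\!]_{\mathbb G}$, except that $$\lambda_{\mathrm{Mean}_v\pi}(\mathbb G)=\mathbb E_{\mathbb T\sim\mathrm{FBP}}\,\lambda_\pi(\mathbb G\sqcup\mathbb T),\qquad \lambda_{\sup_v\pi}(\mathbb G)=\max\Big\{\sup_{v\in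 V(G)}\lambda_\pi(\mathbb G[v]),\ \sup_{\mathbb T}\lambda_\pi(\mathbb G\sqcup\mathbb T)\Big\},$$ where $\mathbb T$ ranges over the finite rooted featured trees. **Similarity.** For $\epsilon,\eta>0$: $(G,\bar v,\chi)\sim_{0,\epsilon,\eta}(H,\bar u,\nu)$ if $\bar v\mapsto\bar u$ is a partial isomorphism and $\|\chi(v_i)-\nu(u_i)\|_\infty\le\epsilon$ for all $i$. For $k\ge1$, $\mathbb G\sim_{k,\epsilon,\eta}\mathbb H$ if: for every $p\in V(G)$ there is $q\in V(H)$, and for every $q\in V(H)$ there is $p\in V(G)$, with $\mathbb G[p]\sim_{k-1,\epsilon,\eta}\mathbb H[q]$; and for every $i$, the root $v_i$ is isolated if and only if $u_i$ is, and, if they are not, there is a coupling of the uniform distributions on $N(v_i)$ and $N(u_i)$ under which $\mathbb G[v]\sim_{k-1,\epsilon,\eta}\mathbb H[u]$ with probability at least $1-\eta$. **Axioms.** A finite MRFG $\mathbb G$ is * $(k,\epsilon,\eta,r)$-*rich* if for all $r'\le r$ and every finite rooted featured tree $\mathbb T$ of height at most $r'$ there are $v_1,\dots,v_k\in V(G)$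 with $B_{r'}(v_i)\sim_{k,\epsilon,\eta}\mathbb T$, at pairwise distances greater than $2r+1$, and each at distance greater than $2r+1$ from every root of $\mathbb G$ and every cycle of length at most $2r+1$; * $(k,\epsilon,\eta,r)$-*close to* $\mathrm{FBP}$ if there is a coupling $(v,\mathbb T)$ of a uniform vertex of $G$ and $\mathrm{FBP}|_r$ with $\Pr(B_r(v)\sim_{k,\epsilon,\eta}\mathbb T)\ge1-\eta$; * $(k,\eta,r)$-*homogeneous* if $(k+\mathrm{Cycle}_r(G))\,\Delta(G)^r/|V(G)|\le\eta$, where $\mathrm{Cycle}_r(G)$ is the number of vertices on cycles of length at most $2r+1$ and $\Delta(G)$ is the maximum degree. **Theorem.** Let $K,k_1,k_2\ge0$ be integers with $k_1+k_2=K$, let $\epsilon,C>0$ and $\eta=\frac{\epsilon}{4C}$, and put $r_i=\frac{3^i-1}{2}$. Let $\tau(\bar w)$ be a term with $|\bar w|\le k_1$ free variables and $\mathrm{rank}(\tau)\le k_2$, such that $|\lambda_{\tau'}|\le C$ on all finite MRFGs for every subterm $\tau'$ of $\tau$. Let $\mathbb G$ be a finite MRFG with $|\bar w|$ roots that is $(k_2,\epsilon,\eta,r_{k_2})$-rich,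 $(k_2,\epsilon,\eta,r_{k_2})$-close to $\mathrm{FBP}$, and $(K,\eta,r_K)$-homogeneous. Then $$\big|[\![\tau]\!]_{\mathbb G}-\lambda_\tau(\mathbb G)\big|\le\epsilon\cdot\mathrm{slope}_\tau\cdot k_2 .$$ -/

import Mathlib

open MeasureTheory ProbabilityTheory
open scoped NNReal ENNReal

namespace AggLogic

/-! ## The term language -/

/-- Terms of the aggregate language over graphs whose vertices carry `d` real features;
`Term d n` are the terms in the free variables `u 0, …, u (n - 1)`. In the constructors that
bind a variable, the bound variable is the last one of the body. -/
inductive Term (d : ℕ) : ℕ → Type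
  /-- real constants -/
  | const {n : ℕ} (a : ℝ) : Term d n
  /-- the `i`-th feature of the vertex `u j` -/
  | val {n : ℕ} (i : Fin d) (j : Fin n) : Term d n
  /-- the indicator of an edge between `u i` and `u j` -/
  | edge {n : ℕ} (i j : Fin n) : Term d n
  /-- the indicator of `u i = u j` -/
  | eq {n : ℕ} (i j : Fin n) : Term d n
  /-- a Lipschitz function applied to terms -/
  | app {n m : ℕ} (F : (Fin m → ℝ) → ℝ) (hF : ∃ L : ℝ≥0, LipschitzWith L F)
      (args : Fin m → Term d n) : Term d n
  /-- the global mean over a vertex `v` -/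
  | mean {n : ℕ} (body : Term d (n + 1)) : Term d n
  /-- the local mean over the neighbours `v` of `u i` -/
  | lmean {n : ℕ} (i : Fin n) (body : Term d (n + 1)) : Term d n
  /-- the supremum over a vertex `v` -/
  | sup {n : ℕ} (body : Term d (n + 1)) : Term d n

/-- The nesting depth of the aggregators (mean, local mean and supremum). -/
def Term.rank {d : ℕ} : {n : ℕ} → Term d n → ℕ
  | _, .const _ => 0
  | _, .val _ _ => 0
  | _, .edge _ _ => 0
  | _, .eq _ _ => 0
  | _, .app _ _ args => Finset.univ.sup fun i => (args i).rank
  | _, .mean body => body.rank + 1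
  | _, .lmean _ body => body.rank + 1
  | _, .sup body => body.rank + 1

/-- `Subterm σ τ`: `σ` is a subterm of `τ` (possibly `τ` itself). -/
inductive Subterm {d m : ℕ} (σ : Term d m) : {n : ℕ} → Term d n → Prop
  | refl : Subterm σ σ
  | app {n l : ℕ} {F : (Fin l → ℝ) → ℝ} {hF : ∃ L : ℝ≥0, LipschitzWith L F}
      {args : Fin l → Term d n} (i : Fin l) :
      Subterm σ (args i) → Subterm σ (Term.app F hF args)
  | mean {n : ℕ} {body : Term d (n + 1)} : Subterm σ body → Subterm σ (Term.mean body)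
  | lmean {n : ℕ} {i : Fin n} {body : Term d (n + 1)} :
      Subterm σ body → Subterm σ (Term.lmean i body)
  | sup {n : ℕ} {body : Term d (n + 1)} : Subterm σ body → Subterm σ (Term.sup body)

/-- The least Lipschitz constant of `F`, for the sup norm on `Fin m → ℝ`. -/
noncomputable def lipConst {m : ℕ} (F : (Fin m → ℝ) → ℝ) : ℝ≥0 :=
  sInf {L : ℝ≥0 | LipschitzWith L F}

/-- The slope of a term. A constant is a Lipschitz function of no arguments, of slope `0`. -/
noncomputable def Term.slope {d : ℕ} : {n : ℕ} → Term d n → ℝ≥0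
  | _, .const _ => 0
  | _, .val _ _ => 1
  | _, .edge _ _ => 1
  | _, .eq _ _ => 1
  | _, .app F _ args => Finset.univ.sup fun i => lipConst F * (args i).slope
  | _, .mean body => body.slope + 1
  | _, .lmean _ body => body.slope + 1
  | _, .sup body => body.slope

/-! ## Multi-rooted featured graphs -/

variable {d : ℕ} {S : Set (Fin d → ℝ)}

/-- A (locally finite, simple) graph with features in the feature space `S` and `n` distinguished
vertices, the roots (not necessarily distinct). The graphs to which the theorem applies are finite;
the infinite ones are needed for the branching process. -/
structure MRFG (S : Set (Fin d → ℝ)) (n : ℕ) where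
  V : Type
  graph : SimpleGraph V
  locFin : ∀ v, (graph.neighborSet v).Finite
  feat : V → S
  roots : Fin n → V

namespace MRFG

variable {n m : ℕ}

/-- The neighbours of a vertex. -/
noncomputable def nbrs (G : MRFG S n) (v : G.V) : Finset G.V := (G.locFin v).toFinset

/-- `𝔾[v]`: the vertex `v` is appended to the list of roots. -/
def addRoot (G : MRFG S n) (v : G.V) : MRFG S (n + 1) where
  V := G.V
  graph := G.graph
  locFin := G.locFin
  feat := G.feat
  roots := Fin.snoc (α := fun _ => G.V) G.roots v

/-- The disjoint union; the roots of the second graph come after those of the first one. -/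
def disjUnion (G : MRFG S n) (H : MRFG S m) : MRFG S (n + m) where
  V := G.V ⊕ H.V
  graph := G.graph ⊕g H.graph
  locFin := by
    rintro (v | v)
    · refine ((G.locFin v).image Sum.inl).subset ?_
      rintro (w | w) hw
      · exact ⟨w, by simpa using hw, rfl⟩
      · simp at hw
    · refine ((H.locFin v).image Sum.inr).subset ?_
      rintro (w | w) hw
      · simp at hw
      · exact ⟨w, by simpa using hw, rfl⟩
  feat := Sum.elim G.feat H.feat
  roots := Fin.append (Sum.inl ∘ G.roots) (Sum.inr ∘ H.roots)

/-- The `r`-neighbourhood of `v`: the subgraph induced on the vertices at distance at most `r`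
from `v`, with `v` as its only root. -/
noncomputable def ball (G : MRFG S n) (r : ℕ) (v : G.V) : MRFG S 1 where
  V := {w : G.V // G.graph.edist v w ≤ (r : ℕ∞)}
  graph := G.graph.induce {w : G.V | G.graph.edist v w ≤ (r : ℕ∞)}
  locFin := fun w => by
    refine Set.Finite.of_finite_image (f := Subtype.val) ((G.locFin w.1).subset ?_)
      Subtype.val_injective.injOn
    rintro _ ⟨x, hx, rfl⟩
    exact hx
  feat := fun w => G.feat w.1
  roots := fun _ => ⟨v, by simp⟩

/-- A finite rooted featured tree. -/
def IsFiniteRootedTree (T : MRFG S 1) : Prop :=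
  Finite T.V ∧ T.graph.IsTree

/-- Every vertex is at distance at most `r` from the root. -/
def HeightLE (T : MRFG S 1) (r : ℕ) : Prop :=
  ∀ v, T.graph.edist (T.roots 0) v ≤ (r : ℕ∞)

/-- `v` lies on some cycle of length at most `l`. -/
def OnShortCycle (G : MRFG S n) (l : ℕ) (v : G.V) : Prop :=
  ∃ p : G.graph.Walk v v, p.IsCycle ∧ p.length ≤ l

end MRFG

/-! ## The featured branching process -/

/-- The sample space of the featured branching process, in Ulam–Harris notation: each potential
individual (a finite list of naturals, where `i :: l` is the `i`-th child of `l`) gets a number of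
children and a feature. -/
abbrev Env (S : Set (Fin d → ℝ)) : Type := List ℕ → ℕ × S

/-- The individuals that are born: the root `[]`, and `i :: l` for `l` born and `i` less than the
number of children of `l`. -/
def Born (ω : Env S) : List ℕ → Prop
  | [] => True
  | i :: l => Born ω l ∧ i < (ω l).1

/-- The rooted featured tree of a sample: the born individuals, each joined to its children. -/
def fbpTree (ω : Env S) : MRFG S 1 where
  V := {l : List ℕ // Born ω l}
  graph :=
    { Adj := fun a b => (∃ i, b.1 = i :: a.1) ∨ (∃ i, a.1 = i :: b.1)
      symm := ⟨fun _ _ h => h.symm⟩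
      loopless := ⟨fun a h => by
        rcases h with ⟨i, h⟩ | ⟨i, h⟩ <;> simpa using congrArg List.length h⟩ }
  locFin := fun a => by
    refine Set.Finite.of_finite_image (f := Subtype.val) (Set.Finite.subset
      (((Set.finite_lt_nat (ω a.1).1).image fun i => i :: a.1).union
        (Set.finite_singleton a.1.tail)) ?_) Subtype.val_injective.injOn
    rintro _ ⟨⟨b, hb⟩, hab, rfl⟩
    rcases hab with ⟨i, h⟩ | ⟨i, h⟩
    · left
      dsimp only at h
      subst h
      exact ⟨i, hb.2, rfl⟩
    · right
      simp [h]
  feat := fun a => (ω a.1).2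
  roots := fun _ => ⟨[], trivial⟩

/-- The law of the featured branching process: the numbers of children are Poisson with mean `c`,
the features have law `D`, and all of them are independent. -/
noncomputable def fbpMeasure (c : ℝ≥0) (D : Measure S) [IsProbabilityMeasure D] :
    Measure (Env S) :=
  Measure.infinitePi fun _ : List ℕ => (poissonMeasure c).prod D

/-- The first `r` generations of the tree of a sample. -/
noncomputable def fbpTrunc (r : ℕ) (ω : Env S) : MRFG S 1 :=
  (fbpTree ω).ball r ((fbpTree ω).roots 0)

/-! ## Values of terms and controllers -/

open Classical in
/-- The value of a term at a finite rooted featured graph, the `j`-th free variable being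
interpreted by the `j`-th root. -/
noncomputable def eval : {n : ℕ} → Term d n → MRFG S n → ℝ
  | _, .const a, _ => a
  | _, .val i j, G => (G.feat (G.roots j)).1 i
  | _, .edge i j, G => if G.graph.Adj (G.roots i) (G.roots j) then 1 else 0
  | _, .eq i j, G => if G.roots i = G.roots j then 1 else 0
  | _, .app F _ args, G => F fun i => eval (args i) G
  | _, .mean body, G => (∑ᶠ v : G.V, eval body (G.addRoot v)) / Nat.card G.V
  | _, .lmean i body, G =>
      if G.nbrs (G.roots i) = ∅ then 0
      else (∑ v ∈ G.nbrs (G.roots i), eval body (G.addRoot v)) / (G.nbrs (G.roots i)).card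
  | _, .sup body, G => ⨆ v : G.V, eval body (G.addRoot v)

open Classical in
/-- The controller `λ_τ`: the value of `τ` on the disjoint union of the given graph with an infinite
featured forest that looks locally like the featured branching process. The supremum over the
union of the two sets is the maximum of the two suprema. -/
noncomputable def controller (c : ℝ≥0) (D : Measure S) [IsProbabilityMeasure D] :
    {n : ℕ} → Term d n → MRFG S n → ℝ
  | _, .const a, _ => a
  | _, .val i j, G => (G.feat (G.roots j)).1 i
  | _, .edge i j, G => if G.graph.Adj (G.roots i) (G.roots j) then 1 else 0
  | _, .eq i j, G => if G.roots i = G.roots j then 1 else 0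
  | _, .app F _ args, G => F fun i => controller c D (args i) G
  | _, .mean body, G => ∫ ω, controller c D body (G.disjUnion (fbpTree ω)) ∂(fbpMeasure c D)
  | _, .lmean i body, G =>
      if G.nbrs (G.roots i) = ∅ then 0
      else (∑ v ∈ G.nbrs (G.roots i), controller c D body (G.addRoot v)) /
        (G.nbrs (G.roots i)).card
  | _, .sup body, G =>
      sSup ({x | ∃ v : G.V, x = controller c D body (G.addRoot v)} ∪
        {x | ∃ T : MRFG S 1, T.IsFiniteRootedTree ∧ x = controller c D body (G.disjUnion T)})

/-! ## The similarity game -/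

/-- `w` is the joint mass function of a coupling of the uniform distributions on the finite
nonempty sets `A` and `B`. -/
def IsUniformCoupling {α β : Type} (A : Finset α) (B : Finset β) (w : α → β → ℝ) : Prop :=
  (∀ a ∈ A, ∀ b ∈ B, 0 ≤ w a b) ∧
  (∀ a ∈ A, ∑ b ∈ B, w a b = 1 / (A.card : ℝ)) ∧
  (∀ b ∈ B, ∑ a ∈ A, w a b = 1 / (B.card : ℝ))

open Classical in
/-- The relation `𝔾 ∼_{k,ε,η} ℍ`. -/
def GameSim (ε η : ℝ) : ℕ → {n : ℕ} → MRFG S n → MRFG S n → Prop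
  | 0, _, G, H =>
      (∀ i j, G.roots i = G.roots j ↔ H.roots i = H.roots j) ∧
      (∀ i j, G.graph.Adj (G.roots i) (G.roots j) ↔ H.graph.Adj (H.roots i) (H.roots j)) ∧
      (∀ i, ‖(G.feat (G.roots i)).1 - (H.feat (H.roots i)).1‖ ≤ ε)
  | k + 1, _, G, H =>
      (∀ p : G.V, ∃ q : H.V, GameSim ε η k (G.addRoot p) (H.addRoot q)) ∧
      (∀ q : H.V, ∃ p : G.V, GameSim ε η k (G.addRoot p) (H.addRoot q)) ∧
      (∀ i, (G.nbrs (G.roots i) = ∅ ↔ H.nbrs (H.roots i) = ∅) ∧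
        (G.nbrs (G.roots i) ≠ ∅ → H.nbrs (H.roots i) ≠ ∅ →
          ∃ w : G.V → H.V → ℝ,
            IsUniformCoupling (G.nbrs (G.roots i)) (H.nbrs (H.roots i)) w ∧
            1 - η ≤ ∑ v ∈ G.nbrs (G.roots i), ∑ u ∈ H.nbrs (H.roots i),
              if GameSim ε η k (G.addRoot v) (H.addRoot u) then w v u else 0))

/-! ## The axioms -/

/-- `G` is `(k, ε, η, r)`-rich. -/
def IsRich {n : ℕ} (k : ℕ) (ε η : ℝ) (r : ℕ) (G : MRFG S n) : Prop :=
  ∀ r' ≤ r, ∀ T : MRFG S 1, T.IsFiniteRootedTree → T.HeightLE r' →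
    ∃ v : Fin k → G.V,
      (∀ i, GameSim ε η k (G.ball r' (v i)) T) ∧
      (∀ i j, i ≠ j → ((2 * r + 1 : ℕ) : ℕ∞) < G.graph.edist (v i) (v j)) ∧
      (∀ i,
        (∀ j, ((2 * r + 1 : ℕ) : ℕ∞) < G.graph.edist (v i) (G.roots j)) ∧
        (∀ u, G.OnShortCycle (2 * r + 1) u →
          ((2 * r + 1 : ℕ) : ℕ∞) < G.graph.edist (v i) u))

/-- `G` is `(k, ε, η, r)`-close to the featured branching process: there is a coupling of a uniform
vertex of `G` with the featured branching process for which the `r`-neighbourhood of the vertex is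
similar to the first `r` generations with probability at least `1 - η`. -/
def IsCloseToFBP (c : ℝ≥0) (D : Measure S) [IsProbabilityMeasure D] {n : ℕ}
    (k : ℕ) (ε η : ℝ) (r : ℕ) (G : MRFG S n) : Prop :=
  letI : MeasurableSpace G.V := ⊤
  ∃ P : Measure (G.V × Env S),
    P.map Prod.fst = uniformOn Set.univ ∧
    P.map Prod.snd = fbpMeasure c D ∧
    1 - η ≤ P.real {x | GameSim ε η k (G.ball r x.1) (fbpTrunc r x.2)}

/-- The number of vertices on cycles of length at most `2 * r + 1`. -/
noncomputable def cycleCount {n : ℕ} (r : ℕ) (G : MRFG S n) : ℕ :=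
  {v | G.OnShortCycle (2 * r + 1) v}.ncard

/-- The maximum degree (of a finite graph). -/
noncomputable def maxDeg {n : ℕ} (G : MRFG S n) : ℕ :=
  ⨆ v : G.V, (G.nbrs v).card

/-- `G` is `(k, η, r)`-homogeneous. -/
def IsHomogeneous {n : ℕ} (k : ℕ) (η : ℝ) (r : ℕ) (G : MRFG S n) : Prop :=
  (((k + cycleCount r G) * maxDeg G ^ r : ℕ) : ℝ) / (Nat.card G.V : ℝ) ≤ η

/-- The radii `r_i = (3 ^ i - 1) / 2` (the division is exact). -/
def radius (i : ℕ) : ℕ := (3 ^ i - 1) / 2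

end AggLogic

open AggLogic

namespace AggLogic

variable {d : ℕ} {S : Set (Fin d → ℝ)}

namespace MRFG

variable {n m k : ℕ}

/-! ### Bounded distances -/

/-- The vertices `a` and `b` are at distance at most `r`. -/
def Near (G : MRFG S n) (r : ℕ) (a b : G.V) : Prop := G.graph.edist a b ≤ (r : ℕ∞)

lemma Near.symm {G : MRFG S n} {r : ℕ} {a b : G.V} (h : G.Near r a b) : G.Near r b a := by
  unfold Near at *
  rwa [SimpleGraph.edist_comm]

lemma Near.trans {G : MRFG S n} {r r' : ℕ} {a b c : G.V} (h : G.Near r a b) (h' : G.Near r' b c) :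
    G.Near (r + r') a c := by
  unfold Near at *
  push_cast
  exact (SimpleGraph.edist_triangle).trans (add_le_add h h')

lemma Near.mono {G : MRFG S n} {r r' : ℕ} {a b : G.V} (h : G.Near r a b) (hr : r ≤ r') :
    G.Near r' a b :=
  le_trans h (by exact_mod_cast hr)

@[simp] lemma near_self (G : MRFG S n) (r : ℕ) (a : G.V) : G.Near r a a := by simp [Near]

@[simp] lemma near_zero_iff {G : MRFG S n} {a b : G.V} : G.Near 0 a b ↔ a = b := by
  simp [Near]

lemma near_one_iff {G : MRFG S n} {a b : G.V} : G.Near 1 a b ↔ G.graph.Adj a b ∨ a = b := by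
  simp [Near]
  exact SimpleGraph.edist_le_one_iff_adj_or_eq

lemma near_of_adj {G : MRFG S n} {a b : G.V} (h : G.graph.Adj a b) {r : ℕ} (hr : 1 ≤ r) :
    G.Near r a b :=
  Near.mono (near_one_iff.2 (Or.inl h)) hr

lemma near_iff_exists_walk {G : MRFG S n} {r : ℕ} {a b : G.V} :
    G.Near r a b ↔ ∃ p : G.graph.Walk a b, p.length ≤ r := by
  constructor
  · intro h
    obtain ⟨p, hp⟩ := SimpleGraph.exists_walk_of_edist_ne_top
      (ne_top_of_le_ne_top (ENat.natCast_ne_top r) h)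
    refine ⟨p, ?_⟩
    unfold Near at h
    rw [← hp] at h
    exact_mod_cast h
  · rintro ⟨p, hp⟩
    exact (SimpleGraph.edist_le p).trans (by exact_mod_cast hp)

lemma Near.split {G : MRFG S n} {r r' : ℕ} {a b : G.V} (h : G.Near (r + r') a b) :
    ∃ c, G.Near r a c ∧ G.Near r' c b := by
  obtain ⟨p, hp⟩ := near_iff_exists_walk.1 h
  refine ⟨p.getVert r, near_iff_exists_walk.2 ⟨p.take r, ?_⟩,
    near_iff_exists_walk.2 ⟨p.drop r, ?_⟩⟩
  · simp [SimpleGraph.Walk.take_length]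
  · simp [SimpleGraph.Walk.drop_length]
    omega

lemma Near.succ_cases {G : MRFG S n} {r : ℕ} {a b : G.V} (h : G.Near (r + 1) a b) :
    G.Near r a b ∨ ∃ c, G.Near r a c ∧ G.graph.Adj c b := by
  obtain ⟨c, h1, h2⟩ := h.split
  rcases near_one_iff.1 h2 with h2 | rfl
  · exact Or.inr ⟨c, h1, h2⟩
  · exact Or.inl h1

lemma finite_near (G : MRFG S n) (r : ℕ) (a : G.V) : {b | G.Near r a b}.Finite := by
  induction r with
  | zero => simp
  | succ r ih =>
    refine (ih.union (ih.biUnion fun c _ => G.locFin c)).subset ?_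
    intro b hb
    rcases Near.succ_cases hb with h | ⟨c, h, h'⟩
    · exact Or.inl h
    · exact Or.inr (Set.mem_biUnion h h')

@[simp] lemma mem_nbrs {G : MRFG S n} {v w : G.V} : w ∈ G.nbrs v ↔ G.graph.Adj v w := by
  simp [nbrs]

/-! ### Embeddings -/

/-- `f` embeds the featured graph `P` into `G` as an induced subgraph. The roots play no role. -/
structure IsEmb (P : MRFG S m) (G : MRFG S n) (f : P.V → G.V) : Prop where
  inj : Function.Injective f
  adj : ∀ x y, G.graph.Adj (f x) (f y) ↔ P.graph.Adj x y
  feat : ∀ x, G.feat (f x) = P.feat x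

/-- All the neighbours of `f x` are in the range of `f`. -/
def FullAt (P : MRFG S m) (G : MRFG S n) (f : P.V → G.V) (x : P.V) : Prop :=
  ∀ w, G.graph.Adj (f x) w → ∃ y, f y = w

/-- `f` is full at every vertex at distance less than `r` from `x`. -/
def FullNear (P : MRFG S m) (G : MRFG S n) (f : P.V → G.V) (r : ℕ) (x : P.V) : Prop :=
  ∀ l, l < r → ∀ y, P.Near l x y → FullAt P G f y

lemma FullNear.mono {P : MRFG S m} {G : MRFG S n} {f : P.V → G.V} {r r' : ℕ} {x : P.V}
    (h : FullNear P G f r x) (hr : r' ≤ r) : FullNear P G f r' x :=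
  fun l hl => h l (hl.trans_le hr)

lemma FullNear.move {P : MRFG S m} {G : MRFG S n} {f : P.V → G.V} {r r' : ℕ} {x y : P.V}
    (h : FullNear P G f (r + r') x) (hxy : P.Near r x y) : FullNear P G f r' y :=
  fun l hl z hz => h (r + l) (by omega) z (hxy.trans hz)

lemma IsEmb.near {P : MRFG S m} {G : MRFG S n} {f : P.V → G.V} (hf : IsEmb P G f) {r : ℕ}
    {x y : P.V} (h : P.Near r x y) : G.Near r (f x) (f y) := by
  induction r generalizing y with
  | zero => simpa using congrArg f (near_zero_iff.1 h)
  | succ r ih =>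
    rcases h.succ_cases with h | ⟨c, h, h'⟩
    · exact (ih h).mono (Nat.le_succ r)
    · exact (ih h).trans (near_of_adj ((hf.adj _ _).2 h') le_rfl)

lemma IsEmb.exists_of_near {P : MRFG S m} {G : MRFG S n} {f : P.V → G.V} (hf : IsEmb P G f)
    {r : ℕ} {x : P.V} (hx : FullNear P G f r x) {w : G.V} (h : G.Near r (f x) w) :
    ∃ y, f y = w ∧ P.Near r x y := by
  induction r generalizing w with
  | zero => exact ⟨x, near_zero_iff.1 h, by simp⟩
  | succ r ih =>
    rcases h.succ_cases with h | ⟨c, h, h'⟩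
    · obtain ⟨y, hy, hxy⟩ := ih (hx.mono (Nat.le_succ r)) h
      exact ⟨y, hy, hxy.mono (Nat.le_succ r)⟩
    · obtain ⟨y, rfl, hxy⟩ := ih (hx.mono (Nat.le_succ r)) h
      obtain ⟨z, rfl⟩ := hx r (Nat.lt_succ_self r) y hxy w h'
      exact ⟨z, rfl, hxy.trans (near_of_adj ((hf.adj _ _).1 h') le_rfl)⟩

lemma IsEmb.comp {P : MRFG S k} {G : MRFG S m} {H : MRFG S n} {f : P.V → G.V} {g : G.V → H.V}
    (hg : IsEmb G H g) (hf : IsEmb P G f) : IsEmb P H (g ∘ f) :=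
  ⟨hg.inj.comp hf.inj, fun _ _ => (hg.adj _ _).trans (hf.adj _ _),
    fun x => (hg.feat _).trans (hf.feat x)⟩

lemma FullAt.comp {P : MRFG S k} {G : MRFG S m} {H : MRFG S n} {f : P.V → G.V} {g : G.V → H.V}
    {x : P.V} (hg' : IsEmb G H g) (hg : FullAt G H g (f x)) (hf : FullAt P G f x) :
    FullAt P H (g ∘ f) x := by
  intro w hw
  obtain ⟨y, rfl⟩ := hg w hw
  obtain ⟨z, rfl⟩ := hf y ((hg'.adj _ _).1 hw)
  exact ⟨z, rfl⟩

lemma isEmb_id (G : MRFG S n) : IsEmb G G id :=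
  ⟨fun _ _ h => h, fun _ _ => Iff.rfl, fun _ => rfl⟩

lemma fullNear_id (G : MRFG S n) (r : ℕ) (x : G.V) : FullNear G G id r x :=
  fun _ _ _ _ w _ => ⟨w, rfl⟩

lemma IsEmb.nbrs_eq {P : MRFG S m} {G : MRFG S n} {f : P.V → G.V} (hf : IsEmb P G f) {x : P.V}
    (hx : FullAt P G f x) : G.nbrs (f x) = (P.nbrs x).map ⟨f, hf.inj⟩ := by
  ext w
  simp only [mem_nbrs, Finset.mem_map, Function.Embedding.coeFn_mk]
  constructor
  · intro h
    obtain ⟨y, rfl⟩ := hx w h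
    exact ⟨y, (hf.adj _ _).1 h, rfl⟩
  · rintro ⟨y, h, rfl⟩
    exact (hf.adj _ _).2 h

/-! ### Balls -/

lemma isEmb_ball (G : MRFG S n) (r : ℕ) (v : G.V) : IsEmb (G.ball r v) G Subtype.val :=
  ⟨Subtype.val_injective, fun _ _ => Iff.rfl, fun _ => rfl⟩

lemma fullNear_ball (G : MRFG S n) (r : ℕ) (v : G.V) :
    FullNear (G.ball r v) G Subtype.val r ((G.ball r v).roots 0) := by
  intro l hl y hy w hw
  have h1 : G.Near l v y.1 := (isEmb_ball G r v).near hy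
  exact ⟨⟨w, (h1.trans (near_of_adj hw le_rfl)).mono hl⟩, rfl⟩

lemma near_ball (G : MRFG S n) (r : ℕ) (v : G.V) (x : (G.ball r v).V) :
    (G.ball r v).Near r ((G.ball r v).roots 0) x := by
  obtain ⟨y, hy, h⟩ := (isEmb_ball G r v).exists_of_near (fullNear_ball G r v) (w := x.1) x.2
  rwa [← Subtype.ext hy]

lemma heightLE_ball (G : MRFG S n) (r : ℕ) (v : G.V) : (G.ball r v).HeightLE r :=
  near_ball G r v

lemma finite_ball (G : MRFG S n) (r : ℕ) (v : G.V) : Finite (G.ball r v).V :=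
  (finite_near G r v).to_subtype

lemma connected_ball (G : MRFG S n) (r : ℕ) (v : G.V) : (G.ball r v).graph.Connected := by
  have key : ∀ x, (G.ball r v).graph.Reachable ((G.ball r v).roots 0) x := fun x =>
    SimpleGraph.reachable_of_edist_ne_top (ne_top_of_le_ne_top (ENat.natCast_ne_top r)
      (near_ball G r v x))
  have : Nonempty (G.ball r v).V := ⟨(G.ball r v).roots 0⟩
  exact ⟨fun x y => (key x).symm.trans (key y)⟩

lemma isFiniteRootedTree_ball (G : MRFG S n) (r : ℕ) (v : G.V)
    (h : (G.ball r v).graph.IsAcyclic) : (G.ball r v).IsFiniteRootedTree :=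
  ⟨finite_ball G r v, connected_ball G r v, h⟩

lemma isAcyclic_ball (G : MRFG S n) (r : ℕ) (v : G.V) (h : G.graph.IsAcyclic) :
    (G.ball r v).graph.IsAcyclic :=
  h.induce _

end MRFG

/-! ### Cycles -/

lemma exists_two_neighbors_of_isCycle {V : Type*} {G : SimpleGraph V} {v : V} {p : G.Walk v v}
    (hp : p.IsCycle) {w : V} (hw : w ∈ p.support) :
    ∃ a ∈ p.support, ∃ b ∈ p.support, a ≠ b ∧ G.Adj w a ∧ G.Adj w b := by
  have h := hp.ncard_neighborSet_toSubgraph_eq_two hw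
  obtain ⟨a, b, hab, h⟩ := Set.ncard_eq_two.1 h
  have ha : p.toSubgraph.Adj w a := by
    have : a ∈ p.toSubgraph.neighborSet w := by rw [h]; simp
    exact this
  have hb : p.toSubgraph.Adj w b := by
    have : b ∈ p.toSubgraph.neighborSet w := by rw [h]; simp
    exact this
  refine ⟨a, ?_, b, ?_, hab, ha.adj_sub, hb.adj_sub⟩
  · simpa using ha.snd_mem
  · simpa using hb.snd_mem

lemma exists_max_of_isCycle {V : Type*} {G : SimpleGraph V} {v : V} {p : G.Walk v v}
    (hp : p.IsCycle) (h : V → ℕ) :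
    ∃ w a b, a ≠ b ∧ G.Adj w a ∧ G.Adj w b ∧ h a ≤ h w ∧ h b ≤ h w := by
  classical
  obtain ⟨w, hw, hmax⟩ := p.support.toFinset.exists_max_image h ⟨v, by simp⟩
  obtain ⟨a, ha, b, hb, hab, h1, h2⟩ := exists_two_neighbors_of_isCycle hp (List.mem_toFinset.1 hw)
  exact ⟨w, a, b, hab, h1, h2, hmax a (by simpa using ha), hmax b (by simpa using hb)⟩

lemma isAcyclic_of_height {V : Type*} {G : SimpleGraph V} (h : V → ℕ)
    (h1 : ∀ a b, G.Adj a b → h a ≠ h b)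
    (h2 : ∀ w a b, G.Adj w a → G.Adj w b → h a < h w → h b < h w → a = b) : G.IsAcyclic := by
  intro v p hp
  obtain ⟨w, a, b, hab, ha, hb, ha', hb'⟩ := exists_max_of_isCycle hp h
  exact hab (h2 w a b ha hb (lt_of_le_of_ne ha' (h1 _ _ ha.symm))
    (lt_of_le_of_ne hb' (h1 _ _ hb.symm)))

lemma exists_cycle_of_two_paths {V : Type*} {G : SimpleGraph V} {a b : V} (p q : G.Walk a b)
    (hp : p.IsPath) (hq : q.IsPath) (hne : p ≠ q) :
    ∃ (u : V) (c : G.Walk u u), c.IsCycle ∧ c.length ≤ p.length + q.length ∧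
      (u ∈ p.support ∨ u ∈ q.support) := by
  classical
  let H : SimpleGraph V := SimpleGraph.fromEdgeSet {e | e ∈ p.edges ∨ e ∈ q.edges}
  have hpH : ∀ e ∈ p.edges, e ∈ H.edgeSet := fun e he => by
    rw [SimpleGraph.edgeSet_fromEdgeSet]
    exact ⟨Or.inl he, G.not_isDiag_of_mem_edgeSet (p.edges_subset_edgeSet he)⟩
  have hqH : ∀ e ∈ q.edges, e ∈ H.edgeSet := fun e he => by
    rw [SimpleGraph.edgeSet_fromEdgeSet]
    exact ⟨Or.inr he, G.not_isDiag_of_mem_edgeSet (q.edges_subset_edgeSet he)⟩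
  have hH : H ≤ G := by
    intro x y h
    rw [SimpleGraph.fromEdgeSet_adj] at h
    rcases h.1 with h | h
    · exact p.edges_subset_edgeSet h
    · exact q.edges_subset_edgeSet h
  have hnot : ¬ H.IsAcyclic := by
    intro hac
    have := (hac.subsingleton_path a b).elim ⟨p.transfer H hpH, hp.transfer hpH⟩
      ⟨q.transfer H hqH, hq.transfer hqH⟩
    apply hne
    have h2 : p.transfer H hpH = q.transfer H hqH := congrArg Subtype.val this
    have h3 := congrArg SimpleGraph.Walk.support h2
    simp only [SimpleGraph.Walk.support_transfer] at h3
    exact SimpleGraph.Walk.ext_support h3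
  simp only [SimpleGraph.IsAcyclic, not_forall, not_not] at hnot
  obtain ⟨u, c, hc⟩ := hnot
  refine ⟨u, c.mapLe hH, hc.mapLe hH, ?_, ?_⟩
  · have h1 : c.edges.toFinset ⊆ p.edges.toFinset ∪ q.edges.toFinset := by
      intro e he
      have := c.edges_subset_edgeSet (List.mem_toFinset.1 he)
      rw [SimpleGraph.edgeSet_fromEdgeSet] at this
      simpa using this.1
    have h2 := Finset.card_le_card h1
    rw [List.toFinset_card_of_nodup hc.edges_nodup] at h2
    have h3 := (h2.trans (Finset.card_union_le _ _)).trans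
      (add_le_add (List.toFinset_card_le _) (List.toFinset_card_le _))
    simpa using h3
  · have hn : H.Adj u c.snd := c.adj_snd hc.not_nil
    rw [SimpleGraph.fromEdgeSet_adj] at hn
    rcases hn.1 with h | h
    · exact Or.inl (p.fst_mem_support_of_mem_edges h)
    · exact Or.inr (q.fst_mem_support_of_mem_edges h)

namespace MRFG

variable {n : ℕ}

lemma exists_short_cycle_of_two_paths {G : MRFG S n} {r l : ℕ} {a b : G.V}
    (p q : G.graph.Walk a b) (hp : p.IsPath) (hq : q.IsPath) (hne : p ≠ q)
    (hl : p.length + q.length ≤ l) (hr : ∀ u, u ∈ p.support ∨ u ∈ q.support → G.Near r a u) :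
    ∃ u, G.Near r a u ∧ G.OnShortCycle l u := by
  obtain ⟨u, c, hc, hlen, hu⟩ := exists_cycle_of_two_paths p q hp hq hne
  exact ⟨u, hr u hu, c, hc, hlen.trans hl⟩

lemma near_of_mem_support {G : MRFG S n} {a b u : G.V} (p : G.graph.Walk a b)
    (hu : u ∈ p.support) : G.Near p.length a u := by
  classical
  exact near_iff_exists_walk.2 ⟨p.takeUntil u hu, p.length_takeUntil_le_length hu⟩

/-- A ball of radius `r` that is not a tree meets a cycle of length at most `2 * r + 1`. -/
lemma exists_short_cycle_of_not_isAcyclic_ball {G : MRFG S n} {r : ℕ} {v : G.V}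
    (h : ¬ (G.ball r v).graph.IsAcyclic) :
    ∃ u, G.Near r v u ∧ G.OnShortCycle (2 * r + 1) u := by
  classical
  simp only [SimpleGraph.IsAcyclic, not_forall, not_not] at h
  obtain ⟨z, c, hc⟩ := h
  have hreach : ∀ x : (G.ball r v).V, G.graph.Reachable v x.1 := fun x =>
    SimpleGraph.reachable_of_edist_ne_top (ne_top_of_le_ne_top (ENat.natCast_ne_top r) x.2)
  have hdist : ∀ x : (G.ball r v).V, G.graph.dist v x.1 ≤ r := fun x => by
    have h1 : G.graph.edist v x.1 ≤ (r : ℕ∞) := x.2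
    rw [← (hreach x).coe_dist_eq_edist] at h1
    exact_mod_cast h1
  obtain ⟨w, a, b, hab, ha, hb, ha', hb'⟩ := exists_max_of_isCycle hc
    fun x : (G.ball r v).V => G.graph.dist v x.1
  have hgeo : ∀ x : (G.ball r v).V, ∃ p : G.graph.Walk v x.1, p.IsPath ∧
      p.length = G.graph.dist v x.1 := fun x => (hreach x).exists_path_of_dist
  have hext : ∀ x : (G.ball r v).V, G.graph.Adj w.1 x.1 → G.graph.dist v x.1 ≤ G.graph.dist v w.1 →
      ∃ p : G.graph.Walk v w.1, p.IsPath ∧ p.penultimate = x.1 ∧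
        p.length = G.graph.dist v x.1 + 1 ∧ ∀ u ∈ p.support, G.Near r v u := by
    intro x hx hle
    obtain ⟨p, hp, hpl⟩ := hgeo x
    have hwp : w.1 ∉ p.support := by
      intro hmem
      have h1 := p.length_takeUntil_lt_length hmem hx.ne
      have h2 := SimpleGraph.dist_le (p.takeUntil w.1 hmem)
      omega
    refine ⟨p.concat hx.symm, hp.concat hwp hx.symm, by simp, by simp [hpl], ?_⟩
    intro u hu
    rw [SimpleGraph.Walk.support_concat] at hu
    simp only [List.mem_append, List.mem_singleton] at hu
    rcases hu with hu | rfl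
    · exact (near_of_mem_support p hu).mono (hpl ▸ hdist x)
    · exact w.2
  have ha1 : G.graph.Adj w.1 a.1 := ha
  have hb1 : G.graph.Adj w.1 b.1 := hb
  obtain ⟨p, hp, hpe, hpl, hps⟩ := hext a ha1 ha'
  obtain ⟨q, hq, hqe, hql, hqs⟩ := hext b hb1 hb'
  have hda := hdist a
  have hdb := hdist b
  have hdw := hdist w
  by_cases hcase : G.graph.dist v a.1 + G.graph.dist v b.1 + 2 ≤ 2 * r + 1
  · refine exists_short_cycle_of_two_paths p q hp hq ?_ (by omega) (by
      rintro u (hu | hu)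
      exacts [hps u hu, hqs u hu])
    rintro rfl
    exact hab (Subtype.ext (hpe.symm.trans hqe))
  · obtain ⟨g, hg, hgl⟩ := hgeo w
    refine exists_short_cycle_of_two_paths p g hp hg ?_ (by omega) ?_
    · rintro rfl
      omega
    · rintro u (hu | hu)
      · exact hps u hu
      · exact (near_of_mem_support g hu).mono (hgl ▸ hdw)

end MRFG

/-! ### Couplings -/

open Classical in
/-- There is a coupling of the uniform distributions on `A` and `B` under which `R` holds with
probability at least `1 - η`. -/
def Coupled {α β : Type} (A : Finset α) (B : Finset β) (R : α → β → Prop) (η : ℝ) : Prop :=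
  ∃ w : α → β → ℝ, IsUniformCoupling A B w ∧
    1 - η ≤ ∑ a ∈ A, ∑ b ∈ B, if R a b then w a b else 0

section Coupled

variable {α β α' β' : Type} {A : Finset α} {B : Finset β} {R R' : α → β → Prop} {η : ℝ}

lemma Coupled.mono (h : Coupled A B R η) (hR : ∀ a ∈ A, ∀ b ∈ B, R a b → R' a b) :
    Coupled A B R' η := by
  obtain ⟨w, hw, h⟩ := h
  refine ⟨w, hw, h.trans (Finset.sum_le_sum fun a ha => Finset.sum_le_sum fun b hb => ?_)⟩
  by_cases h1 : R a b
  · rw [if_pos h1, if_pos (hR a ha b hb h1)]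
  · rw [if_neg h1]
    split_ifs
    exacts [hw.1 a ha b hb, le_rfl]

lemma Coupled.symm (h : Coupled A B R η) : Coupled B A (fun b a => R a b) η := by
  obtain ⟨w, hw, h⟩ := h
  refine ⟨fun b a => w a b, ⟨fun b hb a ha => hw.1 a ha b hb, hw.2.2, hw.2.1⟩, ?_⟩
  rwa [Finset.sum_comm] at h

lemma Coupled.map (f : α ↪ α') (g : β ↪ β') {R' : α' → β' → Prop} (h : Coupled A B R η)
    (hR : ∀ a ∈ A, ∀ b ∈ B, R a b → R' (f a) (g b)) : Coupled (A.map f) (B.map g) R' η := by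
  have h := h.mono (R' := fun a b => R' (f a) (g b)) hR
  obtain ⟨w, hw, h⟩ := h
  classical
  rcases isEmpty_or_nonempty α with hα | hα
  · have hA : A = ∅ := Finset.eq_empty_of_isEmpty A
    subst hA
    have hB : B = ∅ := by
      by_contra hB
      obtain ⟨b, hb⟩ := Finset.nonempty_iff_ne_empty.2 hB
      have h1 := hw.2.2 b hb
      have h2 : (0 : ℝ) < B.card := by exact_mod_cast Finset.card_pos.2 ⟨b, hb⟩
      simp at h1
      linarith
    subst hB
    exact ⟨fun _ _ => 0, ⟨by simp, by simp, by simp⟩, by simpa using h⟩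
  rcases isEmpty_or_nonempty β with hβ | hβ
  · have hB : B = ∅ := Finset.eq_empty_of_isEmpty B
    subst hB
    have hA : A = ∅ := by
      by_contra hA
      obtain ⟨a, ha⟩ := Finset.nonempty_iff_ne_empty.2 hA
      have h1 := hw.2.1 a ha
      have h2 : (0 : ℝ) < A.card := by exact_mod_cast Finset.card_pos.2 ⟨a, ha⟩
      simp at h1
      linarith
    subst hA
    exact ⟨fun _ _ => 0, ⟨by simp, by simp, by simp⟩, by simpa using h⟩
  have hf : ∀ a, Function.invFun f (f a) = a := Function.leftInverse_invFun f.injective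
  have hg : ∀ b, Function.invFun g (g b) = b := Function.leftInverse_invFun g.injective
  refine ⟨fun a b => w (Function.invFun f a) (Function.invFun g b), ⟨?_, ?_, ?_⟩, ?_⟩
  · intro a ha b hb
    obtain ⟨a, ha', rfl⟩ := Finset.mem_map.1 ha
    obtain ⟨b, hb', rfl⟩ := Finset.mem_map.1 hb
    dsimp only
    rw [hf, hg]
    exact hw.1 a ha' b hb'
  · intro a ha
    obtain ⟨a, ha', rfl⟩ := Finset.mem_map.1 ha
    simpa [hf, hg] using hw.2.1 a ha'
  · intro b hb
    obtain ⟨b, hb', rfl⟩ := Finset.mem_map.1 hb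
    simpa [hf, hg] using hw.2.2 b hb'
  · simpa [hf, hg] using h

lemma Coupled.refl (hA : A.Nonempty) (hη : 0 ≤ η) : Coupled A A (fun a b => a = b) η := by
  classical
  have hc : (A.card : ℝ) ≠ 0 := by exact_mod_cast (Finset.card_pos.2 hA).ne'
  refine ⟨fun a b => if a = b then 1 / (A.card : ℝ) else 0, ⟨?_, ?_, ?_⟩, ?_⟩
  · intro a _ b _
    dsimp only
    split_ifs
    · positivity
    · exact le_rfl
  · intro a ha
    simp [ha]
  · intro b hb
    simp [hb]
  · have : ∀ a ∈ A, (∑ b ∈ A, if a = b then (if a = b then 1 / (A.card : ℝ) else 0) else 0)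
        = 1 / (A.card : ℝ) := by
      intro a ha
      rw [Finset.sum_eq_single a] <;> simp +contextual [ha, eq_comm]
    rw [Finset.sum_congr rfl this]
    simp [hc, hη]

/-- If `f` and `g` are coupled so that they are close with high probability, their averages are
close. -/
lemma Coupled.abs_average_sub_le (h : Coupled A B R η) (hA : A.Nonempty)
    {f : α → ℝ} {g : β → ℝ} {δ C : ℝ} (hδ : 0 ≤ δ) (hC : 0 ≤ C)
    (hR : ∀ a ∈ A, ∀ b ∈ B, R a b → |f a - g b| ≤ δ)
    (hf : ∀ a ∈ A, |f a| ≤ C) (hg : ∀ b ∈ B, |g b| ≤ C) :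
    |(∑ a ∈ A, f a) / A.card - (∑ b ∈ B, g b) / B.card| ≤ δ + 2 * C * η := by
  classical
  obtain ⟨w, hw, h⟩ := h
  have hcA : (A.card : ℝ) ≠ 0 := by exact_mod_cast (Finset.card_pos.2 hA).ne'
  have h1 : (∑ a ∈ A, f a) / A.card = ∑ a ∈ A, ∑ b ∈ B, w a b * f a := by
    rw [Finset.sum_div]
    refine Finset.sum_congr rfl fun a ha => ?_
    rw [← Finset.sum_mul, hw.2.1 a ha]
    ring
  have h2 : (∑ b ∈ B, g b) / B.card = ∑ a ∈ A, ∑ b ∈ B, w a b * g b := by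
    rw [Finset.sum_comm, Finset.sum_div]
    refine Finset.sum_congr rfl fun b hb => ?_
    rw [← Finset.sum_mul, hw.2.2 b hb]
    ring
  have htot : ∑ a ∈ A, ∑ b ∈ B, w a b = 1 := by
    rw [Finset.sum_congr rfl hw.2.1]
    simp [hcA]
  have hpt : ∀ a ∈ A, ∀ b ∈ B, |w a b * f a - w a b * g b| ≤
      (δ * w a b) + 2 * C * (w a b - if R a b then w a b else 0) := by
    intro a ha b hb
    have hw0 := hw.1 a ha b hb
    rw [← mul_sub, abs_mul, abs_of_nonneg hw0]
    by_cases hab : R a b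
    · rw [if_pos hab]
      nlinarith [mul_le_mul_of_nonneg_left (hR a ha b hb hab) hw0]
    · rw [if_neg hab]
      have h3 : |f a - g b| ≤ 2 * C := by
        have := abs_sub (f a) (g b)
        linarith [hf a ha, hg b hb]
      nlinarith [mul_le_mul_of_nonneg_left h3 hw0, mul_nonneg hδ hw0]
  rw [h1, h2]
  simp only [← Finset.sum_sub_distrib]
  calc |∑ a ∈ A, ∑ b ∈ B, (w a b * f a - w a b * g b)|
      ≤ ∑ a ∈ A, ∑ b ∈ B, |w a b * f a - w a b * g b| :=
        (Finset.abs_sum_le_sum_abs _ _).trans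
          (Finset.sum_le_sum fun a _ => Finset.abs_sum_le_sum_abs _ _)
    _ ≤ ∑ a ∈ A, ∑ b ∈ B, ((δ * w a b) + 2 * C * (w a b - if R a b then w a b else 0)) :=
        Finset.sum_le_sum fun a ha => Finset.sum_le_sum fun b hb => hpt a ha b hb
    _ = δ * (∑ a ∈ A, ∑ b ∈ B, w a b) + 2 * C * ((∑ a ∈ A, ∑ b ∈ B, w a b) -
          ∑ a ∈ A, ∑ b ∈ B, if R a b then w a b else 0) := by
        simp only [Finset.sum_add_distrib, Finset.sum_sub_distrib, Finset.mul_sum, mul_sub]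
    _ ≤ δ + 2 * C * η := by
        rw [htot]
        nlinarith

end Coupled

/-! ### Properties of the similarity game -/

namespace MRFG

variable {n m : ℕ}

/-- The graph `G` with the list of roots rearranged along `h`. -/
def comapRoots (G : MRFG S n) (h : Fin m → Fin n) : MRFG S m where
  V := G.V
  graph := G.graph
  locFin := G.locFin
  feat := G.feat
  roots := G.roots ∘ h

/-- The map of root indices that fixes a new last root. -/
def liftIndex (h : Fin m → Fin n) : Fin (m + 1) → Fin (n + 1) :=
  Fin.snoc (α := fun _ => Fin (n + 1)) (fun i => (h i).castSucc) (Fin.last n)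

lemma comapRoots_addRoot (G : MRFG S n) (h : Fin m → Fin n) (p : G.V) :
    (G.comapRoots h).addRoot p = (G.addRoot p).comapRoots (liftIndex h) := by
  have : Fin.snoc (α := fun _ => G.V) (G.roots ∘ h) p =
      Fin.snoc (α := fun _ => G.V) G.roots p ∘ liftIndex h := by
    funext i
    refine Fin.lastCases ?_ (fun i => ?_) i <;> simp [liftIndex]
  simp only [comapRoots, addRoot, this]

lemma addRoot_comapRoots_castSucc (G : MRFG S n) (p : G.V) :
    (G.addRoot p).comapRoots Fin.castSucc = G := by
  have : Fin.snoc (α := fun _ => G.V) G.roots p ∘ Fin.castSucc = G.roots := by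
    funext i
    simp
  simp only [comapRoots, addRoot, this]

@[simp] lemma addRoot_roots_castSucc (G : MRFG S n) (p : G.V) (i : Fin n) :
    (G.addRoot p).roots i.castSucc = G.roots i := by
  simp [addRoot]

@[simp] lemma addRoot_roots_last (G : MRFG S n) (p : G.V) :
    (G.addRoot p).roots (Fin.last n) = p := by
  simp [addRoot]

end MRFG

section GameSim

variable {ε η : ℝ} {n m k : ℕ}

lemma gameSim_zero {G H : MRFG S n} : GameSim ε η 0 G H ↔
    (∀ i j, G.roots i = G.roots j ↔ H.roots i = H.roots j) ∧
    (∀ i j, G.graph.Adj (G.roots i) (G.roots j) ↔ H.graph.Adj (H.roots i) (H.roots j)) ∧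
    (∀ i, ‖(G.feat (G.roots i)).1 - (H.feat (H.roots i)).1‖ ≤ ε) := Iff.rfl

lemma gameSim_succ {G H : MRFG S n} : GameSim ε η (k + 1) G H ↔
    (∀ p : G.V, ∃ q : H.V, GameSim ε η k (G.addRoot p) (H.addRoot q)) ∧
    (∀ q : H.V, ∃ p : G.V, GameSim ε η k (G.addRoot p) (H.addRoot q)) ∧
    (∀ i, (G.nbrs (G.roots i) = ∅ ↔ H.nbrs (H.roots i) = ∅) ∧
      (G.nbrs (G.roots i) ≠ ∅ → H.nbrs (H.roots i) ≠ ∅ →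
        Coupled (G.nbrs (G.roots i)) (H.nbrs (H.roots i))
          (fun v u => GameSim ε η k (G.addRoot v) (H.addRoot u)) η)) := Iff.rfl

lemma GameSim.symm {G H : MRFG S n} (h : GameSim ε η k G H) : GameSim ε η k H G := by
  induction k generalizing n with
  | zero =>
    rw [gameSim_zero] at *
    refine ⟨fun i j => (h.1 i j).symm, fun i j => (h.2.1 i j).symm, fun i => ?_⟩
    rw [norm_sub_rev]
    exact h.2.2 i
  | succ k ih =>
    rw [gameSim_succ] at *
    refine ⟨fun p => ?_, fun q => ?_, fun i => ⟨(h.2.2 i).1.symm, fun h1 h2 => ?_⟩⟩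
    · obtain ⟨q, hq⟩ := h.2.1 p
      exact ⟨q, ih hq⟩
    · obtain ⟨p, hp⟩ := h.1 q
      exact ⟨p, ih hp⟩
    · exact ((h.2.2 i).2 h2 h1).symm.mono fun a _ b _ hab => ih hab

lemma GameSim.comapRoots {G H : MRFG S n} (hsim : GameSim ε η k G H) (h : Fin m → Fin n) :
    GameSim ε η k (G.comapRoots h) (H.comapRoots h) := by
  induction k generalizing n m with
  | zero => exact ⟨fun i j => hsim.1 _ _, fun i j => hsim.2.1 _ _, fun i => hsim.2.2 _⟩
  | succ k ih =>
    rw [gameSim_succ] at *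
    have key : ∀ p q, GameSim ε η k (G.addRoot p) (H.addRoot q) →
        GameSim ε η k ((G.comapRoots h).addRoot p) ((H.comapRoots h).addRoot q) := by
      intro p q hpq
      rw [MRFG.comapRoots_addRoot, MRFG.comapRoots_addRoot]
      exact ih hpq _
    refine ⟨fun p => ?_, fun q => ?_, fun i => ⟨(hsim.2.2 (h i)).1, fun h1 h2 => ?_⟩⟩
    · obtain ⟨q, hq⟩ := hsim.1 p
      exact ⟨q, key p q hq⟩
    · obtain ⟨p, hp⟩ := hsim.2.1 q
      exact ⟨p, key p q hp⟩
    · exact ((hsim.2.2 (h i)).2 h1 h2).mono fun a _ b _ hab => key a b hab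

lemma GameSim.exists_addRoot {G H : MRFG S n} (h : GameSim ε η (k + 1) G H) [Nonempty G.V] :
    ∃ p q, GameSim ε η k (G.addRoot p) (H.addRoot q) := by
  obtain ⟨p⟩ := ‹Nonempty G.V›
  obtain ⟨q, hq⟩ := (gameSim_succ.1 h).1 p
  exact ⟨p, q, hq⟩

lemma GameSim.of_succ {G H : MRFG S n} (h : GameSim ε η (k + 1) G H) [Nonempty G.V] :
    GameSim ε η k G H := by
  obtain ⟨p, q, hpq⟩ := h.exists_addRoot
  simpa only [MRFG.addRoot_comapRoots_castSucc] using hpq.comapRoots Fin.castSucc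

lemma GameSim.mono {G H : MRFG S n} [Nonempty G.V] {l : ℕ} (h : GameSim ε η k G H) (hl : l ≤ k) :
    GameSim ε η l G H := by
  induction k with
  | zero => obtain rfl := Nat.le_zero.1 hl; exact h
  | succ k ih =>
    rcases Nat.lt_or_ge k l with h1 | h1
    · obtain rfl : l = k + 1 := by omega
      exact h
    · exact ih h.of_succ h1

/-- Graphs with an isomorphism that moves the features little are similar. -/
lemma GameSim.of_iso {G H : MRFG S n} (hη : 0 ≤ η) (e : G.V ≃ H.V)
    (hadj : ∀ x y, H.graph.Adj (e x) (e y) ↔ G.graph.Adj x y)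
    (hroots : ∀ i, e (G.roots i) = H.roots i)
    (hfeat : ∀ x, ‖(G.feat x).1 - (H.feat (e x)).1‖ ≤ ε) : GameSim ε η k G H := by
  induction k generalizing n with
  | zero =>
    refine ⟨fun i j => ?_, fun i j => ?_, fun i => ?_⟩
    · rw [← hroots, ← hroots, e.injective.eq_iff]
    · rw [← hroots, ← hroots, hadj]
    · rw [← hroots]
      exact hfeat _
  | succ k ih =>
    have key : ∀ p, GameSim ε η k (G.addRoot p) (H.addRoot (e p)) := by
      intro p
      refine ih (G := G.addRoot p) (H := H.addRoot (e p)) e hadj (fun i => ?_) hfeat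
      refine Fin.lastCases ?_ (fun i => ?_) i
      · rw [MRFG.addRoot_roots_last, MRFG.addRoot_roots_last]
        rfl
      · rw [MRFG.addRoot_roots_castSucc, MRFG.addRoot_roots_castSucc]
        exact hroots i
    have hn : ∀ x, H.nbrs (e x) = (G.nbrs x).map e.toEmbedding := by
      intro x
      ext y
      obtain ⟨y, rfl⟩ := e.surjective y
      simp [hadj]
    rw [gameSim_succ]
    refine ⟨fun p => ⟨e p, key p⟩, fun q => ⟨e.symm q, by simpa using key (e.symm q)⟩,
      fun i => ⟨?_, fun h1 h2 => ?_⟩⟩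
    · rw [← hroots, hn, Finset.map_eq_empty]
    · rw [← hroots, hn]
      have h3 := (Coupled.refl (Finset.nonempty_iff_ne_empty.2 h1) hη).map
        (Function.Embedding.refl _) e.toEmbedding
        (R' := fun v u => GameSim ε η k (G.addRoot v) (H.addRoot u)) (by
          rintro a _ b _ rfl
          exact key a)
      rwa [Finset.map_refl] at h3

lemma GameSim.refl (G : MRFG S n) (hε : 0 ≤ ε) (hη : 0 ≤ η) : GameSim ε η k G G :=
  GameSim.of_iso hη (Equiv.refl _) (fun _ _ => Iff.rfl) (fun _ => rfl) (fun _ => by simpa using hε)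

/-- The game with `k` moves detects distances up to `2 ^ k`. -/
lemma GameSim.near {G H : MRFG S n} (h : GameSim ε η k G H) {i j : Fin n}
    (hij : G.Near (2 ^ k) (G.roots i) (G.roots j)) : H.Near (2 ^ k) (H.roots i) (H.roots j) := by
  induction k generalizing n with
  | zero =>
    rw [pow_zero, MRFG.near_one_iff] at *
    exact hij.imp (h.2.1 i j).1 (h.1 i j).1
  | succ k ih =>
    rw [pow_succ, mul_two] at *
    obtain ⟨p, h1, h2⟩ := hij.split
    obtain ⟨q, hq⟩ := (gameSim_succ.1 h).1 p
    have h3 := ih hq (i := i.castSucc) (j := Fin.last n) (by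
      rw [MRFG.addRoot_roots_castSucc, MRFG.addRoot_roots_last]
      exact h1)
    have h4 := ih hq (i := Fin.last n) (j := j.castSucc) (by
      rw [MRFG.addRoot_roots_castSucc, MRFG.addRoot_roots_last]
      exact h2)
    simp only [MRFG.addRoot_roots_castSucc, MRFG.addRoot_roots_last] at h3 h4
    exact MRFG.Near.trans (G := H) h3 h4

end GameSim

/-! ### Adding a component without root -/

namespace MRFG

variable {n m : ℕ}

/-- The disjoint union of `G` and `T`, with the roots of `G` only. -/
def sumRight (G : MRFG S n) (T : MRFG S m) : MRFG S n where
  V := (G.disjUnion T).V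
  graph := (G.disjUnion T).graph
  locFin := (G.disjUnion T).locFin
  feat := (G.disjUnion T).feat
  roots := Sum.inl ∘ G.roots

lemma disjUnion_eq (G : MRFG S n) (T : MRFG S 1) :
    G.disjUnion T = (G.sumRight T).addRoot (Sum.inr (T.roots 0)) := by
  have := Fin.append_right_eq_snoc (Sum.inl ∘ G.roots : Fin n → G.V ⊕ T.V) (Sum.inr ∘ T.roots)
  simp only [disjUnion, sumRight, addRoot, this, Function.comp_apply]

lemma isEmb_inl (G : MRFG S n) (T : MRFG S m) : IsEmb G (G.sumRight T) Sum.inl :=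
  ⟨Sum.inl_injective, fun _ _ => SimpleGraph.sum_adj_inl, fun _ => rfl⟩

lemma isEmb_inr (G : MRFG S n) (T : MRFG S m) : IsEmb T (G.sumRight T) Sum.inr :=
  ⟨Sum.inr_injective, fun _ _ => SimpleGraph.sum_adj_inr, fun _ => rfl⟩

lemma fullAt_inl (G : MRFG S n) (T : MRFG S m) (x : G.V) :
    FullAt G (G.sumRight T) Sum.inl x := by
  rintro (w | w) h
  · exact ⟨w, rfl⟩
  · simp [sumRight, disjUnion] at h

lemma fullAt_inr (G : MRFG S n) (T : MRFG S m) (x : T.V) :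
    FullAt T (G.sumRight T) Sum.inr x := by
  rintro (w | w) h
  · simp [sumRight, disjUnion] at h
  · exact ⟨w, rfl⟩

lemma not_near_inl_inr (G : MRFG S n) (T : MRFG S m) (r : ℕ) (x : G.V) (y : T.V) :
    ¬ (G.sumRight T).Near r (Sum.inl x) (Sum.inr y) := by
  intro h
  obtain ⟨z, hz, -⟩ := (isEmb_inl G T).exists_of_near (fun _ _ z _ => fullAt_inl G T z) h
  simp at hz

lemma near_inl_iff (G : MRFG S n) (T : MRFG S m) {r : ℕ} {x y : G.V} :
    (G.sumRight T).Near r (Sum.inl x) (Sum.inl y) ↔ G.Near r x y := by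
  refine ⟨fun h => ?_, (isEmb_inl G T).near⟩
  obtain ⟨z, hz, h⟩ := (isEmb_inl G T).exists_of_near (fun _ _ z _ => fullAt_inl G T z) h
  rwa [← Sum.inl_injective hz]

/-- Around `p`, up to distance `r`, the graph is a finite tree. -/
def HasTree (G : MRFG S n) (r : ℕ) (p : G.V) : Prop :=
  ∃ T : MRFG S 1, T.IsFiniteRootedTree ∧ ∃ f : T.V → G.V, IsEmb T G f ∧ f (T.roots 0) = p ∧
    FullNear T G f r (T.roots 0)

lemma hasTree_of_isAcyclic_ball {G : MRFG S n} {r : ℕ} {p : G.V}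
    (h : (G.ball r p).graph.IsAcyclic) : G.HasTree r p :=
  ⟨G.ball r p, isFiniteRootedTree_ball G r p h, Subtype.val, isEmb_ball G r p, rfl,
    fullNear_ball G r p⟩

lemma HasTree.map {G : MRFG S n} {H : MRFG S m} {r : ℕ} {p : G.V} (h : G.HasTree r p)
    {e : G.V → H.V} (he : IsEmb G H e) (hfull : ∀ x, FullAt G H e x) : H.HasTree r (e p) := by
  obtain ⟨T, hT, f, hf, rfl, hfn⟩ := h
  exact ⟨T, hT, e ∘ f, he.comp hf, rfl,
    fun l hl y hy => FullAt.comp he (hfull _) (hfn l hl y hy)⟩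

end MRFG

open MRFG

/-! ### Local similarity -/

/-- One side of a local similarity: the graph `G` consists, up to trees, of an embedded
copy of `base`, and every root of `G` lies in this copy or in one of the patches `P t`, which
represent `G` faithfully up to distance `2 ^ j` from their roots. -/
structure Side {n : ℕ} {ι : Type} (base : MRFG S 0) (X : Set base.V) (cl : Fin n → Option ι)
    (P : ι → MRFG S n) (s j : ℕ) (G : MRFG S n) (e : base.V → G.V)
    (f : ∀ t, (P t).V → G.V) : Prop where
  emb_base : IsEmb base G e
  full_base : ∀ x, FullAt base G e x
  tree : ∀ p, (∀ x ∈ X, e x ≠ p) → G.HasTree s p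
  emb : ∀ t, IsEmb (P t) G (f t)
  nonempty : ∀ t, Nonempty (P t).V
  roots_eq : ∀ i t, cl i = some t → f t ((P t).roots i) = G.roots i
  full : ∀ i t, cl i = some t → FullNear (P t) G (f t) (2 ^ j) ((P t).roots i)
  far : ∀ i i', cl i ≠ cl i' → ¬ G.Near (2 ^ j) (G.roots i) (G.roots i')
  far_base : ∀ i t, cl i = some t → ∀ x ∈ X, ¬ G.Near (2 ^ j) (G.roots i) (e x)

namespace Side

variable {n s j : ℕ} {ι : Type} {base : MRFG S 0} {X : Set base.V} {cl : Fin n → Option ι}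
  {P : ι → MRFG S n} {G : MRFG S n} {e : base.V → G.V} {f : ∀ t, (P t).V → G.V}

lemma addRoot (h : Side base X cl P s (j + 1) G e f) (c : Option ι) (p : G.V)
    (x : ∀ t, (P t).V)
    (hc : ∀ t, c = some t → f t (x t) = p ∧ FullNear (P t) G (f t) (2 ^ j) (x t))
    (hfar : ∀ i, cl i ≠ c → ¬ G.Near (2 ^ j) (G.roots i) p)
    (hfarX : ∀ t, c = some t → ∀ y ∈ X, ¬ G.Near (2 ^ j) p (e y)) :
    Side base X (Fin.snoc (α := fun _ => Option ι) cl c) (fun t => (P t).addRoot (x t)) s j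
      (G.addRoot p) e f where
  emb_base := ⟨h.emb_base.inj, h.emb_base.adj, h.emb_base.feat⟩
  full_base := h.full_base
  tree q hq := by
    obtain ⟨T, hT, g, hg, hgp, hgf⟩ := h.tree q hq
    exact ⟨T, hT, g, ⟨hg.inj, hg.adj, hg.feat⟩, hgp, hgf⟩
  emb t := ⟨(h.emb t).inj, (h.emb t).adj, (h.emb t).feat⟩
  nonempty := h.nonempty
  roots_eq i t := by
    refine Fin.lastCases (fun ht => ?_) (fun i ht => ?_) i
    · rw [addRoot_roots_last, addRoot_roots_last]
      exact (hc t (by simpa using ht)).1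
    · rw [addRoot_roots_castSucc, addRoot_roots_castSucc]
      exact h.roots_eq i t (by simpa using ht)
  full i t := by
    refine Fin.lastCases (fun ht => ?_) (fun i ht => ?_) i
    · rw [addRoot_roots_last]
      exact (hc t (by simpa using ht)).2
    · rw [addRoot_roots_castSucc]
      exact (h.full i t (by simpa using ht)).mono (Nat.pow_le_pow_right (by norm_num) (by omega))
  far i i' := by
    refine Fin.lastCases ?_ (fun i => ?_) i <;> refine Fin.lastCases ?_ (fun i' => ?_) i'
    · simp
    · intro hne hnear
      rw [Fin.snoc_last, Fin.snoc_castSucc] at hne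
      rw [addRoot_roots_castSucc, addRoot_roots_last] at hnear
      exact hfar i' hne.symm hnear.symm
    · intro hne hnear
      rw [Fin.snoc_last, Fin.snoc_castSucc] at hne
      rw [addRoot_roots_castSucc, addRoot_roots_last] at hnear
      exact hfar i hne hnear
    · intro hne hnear
      rw [Fin.snoc_castSucc, Fin.snoc_castSucc] at hne
      rw [addRoot_roots_castSucc, addRoot_roots_castSucc] at hnear
      exact h.far i i' hne (Near.mono (G := G) hnear
        (Nat.pow_le_pow_right (by norm_num) (by omega)))
  far_base i t := by
    refine Fin.lastCases (fun ht => ?_) (fun i ht => ?_) i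
    · rw [addRoot_roots_last]
      exact hfarX t (by simpa using ht)
    · rw [addRoot_roots_castSucc]
      exact fun y hy hnear => h.far_base i t (by simpa using ht) y hy (Near.mono (G := G) hnear
        (Nat.pow_le_pow_right (by norm_num) (by omega)))

lemma addRoot_patch (h : Side base X cl P s (j + 1) G e f) {i : Fin n} {t : ι}
    (hi : cl i = some t) (x : ∀ t, (P t).V) (hx : (P t).Near (2 ^ j) ((P t).roots i) (x t)) :
    Side base X (Fin.snoc (α := fun _ => Option ι) cl (some t)) (fun t => (P t).addRoot (x t)) s j
      (G.addRoot (f t (x t))) e f := by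
  have hp : G.Near (2 ^ j) (G.roots i) (f t (x t)) := by
    rw [← h.roots_eq i t hi]
    exact (h.emb t).near hx
  have h2 : 2 ^ (j + 1) = 2 ^ j + 2 ^ j := by ring
  refine h.addRoot _ _ x ?_ ?_ ?_
  · rintro t' ht'
    obtain rfl := Option.some.inj ht'
    refine ⟨rfl, FullNear.move (r := 2 ^ j) ?_ hx⟩
    rw [← h2]
    exact h.full i t hi
  · intro i' hi' hnear
    refine h.far i' i (by rwa [hi]) ?_
    rw [h2]
    exact hnear.trans hp.symm
  · intro t' _ y hy hnear
    refine h.far_base i t hi y hy ?_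
    rw [h2]
    exact hp.trans hnear

lemma addRoot_base (h : Side base X cl P s (j + 1) G e f) {x y : base.V}
    (hy : y ∈ X ∨ ∃ i, cl i = none ∧ e y = G.roots i) (hxy : base.Near (2 ^ j) y x)
    (z : ∀ t, (P t).V) :
    Side base X (Fin.snoc (α := fun _ => Option ι) cl none) (fun t => (P t).addRoot (z t)) s j
      (G.addRoot (e x)) e f := by
  have h2 : 2 ^ (j + 1) = 2 ^ j + 2 ^ j := by ring
  have hnear : G.Near (2 ^ j) (e y) (e x) := h.emb_base.near hxy
  refine h.addRoot _ _ z (by simp) ?_ (by simp)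
  intro i hi hn
  obtain ⟨t, ht⟩ := Option.ne_none_iff_exists'.1 hi
  have hn2 : G.Near (2 ^ (j + 1)) (G.roots i) (e y) := by
    rw [h2]
    exact hn.trans hnear.symm
  rcases hy with hy | ⟨i', hi', hy⟩
  · exact h.far_base i t ht y hy hn2
  · refine h.far i i' (by rw [hi', ht]; simp) ?_
    rwa [← hy]

/-- The patches, extended by one more. -/
def consPatch (P : ι → MRFG S n) (P' : MRFG S n) : Option ι → MRFG S n :=
  fun t => t.elim P' P

/-- The embeddings of the patches, extended by one more. -/
def consEmb (f : ∀ t, (P t).V → G.V) {P' : MRFG S n} (f' : P'.V → G.V) :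
    ∀ t, (consPatch P P' t).V → G.V
  | none => f'
  | some t => f t

lemma cons (h : Side base X cl P s j G e f) {P' : MRFG S n} {f' : P'.V → G.V}
    (hf' : IsEmb P' G f') (hP' : Nonempty P'.V) :
    Side base X (fun i => (cl i).map some) (consPatch P P') s j G e (consEmb f f') where
  emb_base := h.emb_base
  full_base := h.full_base
  tree := h.tree
  emb t := by
    cases t
    exacts [hf', h.emb _]
  nonempty t := by
    cases t
    exacts [hP', h.nonempty _]
  roots_eq i t ht := by
    obtain ⟨t, ht', rfl⟩ := Option.map_eq_some_iff.1 ht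
    exact h.roots_eq i t ht'
  full i t ht := by
    obtain ⟨t, ht', rfl⟩ := Option.map_eq_some_iff.1 ht
    exact h.full i t ht'
  far i i' hne := h.far i i' fun heq => hne (by rw [heq])
  far_base i t ht := by
    obtain ⟨t, ht', rfl⟩ := Option.map_eq_some_iff.1 ht
    exact h.far_base i t ht'

lemma sumRight (h : Side base X cl P s j G e f) {T : MRFG S 1} (hT : T.graph.IsAcyclic) :
    Side base X cl P s j (G.sumRight T) (Sum.inl ∘ e) (fun t => Sum.inl ∘ f t) where
  emb_base := (isEmb_inl G T).comp h.emb_base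
  full_base x := FullAt.comp (isEmb_inl G T) (fullAt_inl G T _) (h.full_base x)
  tree := by
    rintro (p | p) hp
    · exact (h.tree p fun x hx hxp => hp x hx (congrArg Sum.inl hxp)).map (isEmb_inl G T)
        (fullAt_inl G T)
    · exact (hasTree_of_isAcyclic_ball (isAcyclic_ball T s p hT)).map (isEmb_inr G T)
        (fullAt_inr G T)
  emb t := (isEmb_inl G T).comp (h.emb t)
  nonempty := h.nonempty
  roots_eq i t ht := congrArg Sum.inl (h.roots_eq i t ht)
  full i t ht l hl y hy := FullAt.comp (isEmb_inl G T) (fullAt_inl G T _) (h.full i t ht l hl y hy)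
  far i i' hne hnear := h.far i i' hne ((near_inl_iff G T).1 hnear)
  far_base i t ht x hx hnear := h.far_base i t ht x hx ((near_inl_iff G T).1 hnear)

end Side

/-- `G` and `H` are locally similar: they consist, up to trees, of the same graph `base`, and the
corresponding roots lie either at the same vertex of `base` or in patches that are similar. -/
def LocalSim (ε η : ℝ) (s j : ℕ) {n : ℕ} (G H : MRFG S n) : Prop :=
  ∃ (base : MRFG S 0) (X : Set base.V) (ι : Type) (cl : Fin n → Option ι) (P Q : ι → MRFG S n)
    (e : base.V → G.V) (e' : base.V → H.V) (f : ∀ t, (P t).V → G.V) (g : ∀ t, (Q t).V → H.V),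
    Side base X cl P s j G e f ∧ Side base X cl Q s j H e' g ∧
    (∀ t, GameSim ε η j (P t) (Q t)) ∧
    ∀ i, cl i = none → ∃ x, e x = G.roots i ∧ e' x = H.roots i

namespace LocalSim

variable {ε η : ℝ} {s j n : ℕ} {G H : MRFG S n}

lemma symm (h : LocalSim ε η s j G H) : LocalSim ε η s j H G := by
  obtain ⟨base, X, ι, cl, P, Q, e, e', f, g, hG, hH, hsim, hroot⟩ := h
  exact ⟨base, X, ι, cl, Q, P, e', e, g, f, hH, hG, fun t => (hsim t).symm,
    fun i hi => (hroot i hi).imp fun _ => And.symm⟩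

/-- A graph is locally similar to itself; the exceptional set of the base consists of the vertices
around which the graph is not a tree. -/
lemma refl_side (G : MRFG S n) (s j : ℕ) :
    Side (ι := Empty) (G.comapRoots Fin.elim0) {p | ¬ G.HasTree s p} (fun _ => none)
      (fun t => t.elim) s j G id (fun t => t.elim) where
  emb_base := ⟨fun _ _ h => h, fun _ _ => Iff.rfl, fun _ => rfl⟩
  full_base _ w _ := ⟨w, rfl⟩
  tree p hp := by
    by_contra h
    exact hp p h rfl
  emb t := t.elim
  nonempty t := t.elim
  roots_eq := by simp
  full := by simp
  far := by simp
  far_base := by simp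

lemma of_patch {base : MRFG S 0} {X : Set base.V} {ι : Type} {cl : Fin n → Option ι}
    {P Q : ι → MRFG S n} {e : base.V → G.V} {e' : base.V → H.V} {f : ∀ t, (P t).V → G.V}
    {g : ∀ t, (Q t).V → H.V} (hG : Side base X cl P s (j + 1) G e f)
    (hH : Side base X cl Q s (j + 1) H e' g) (hsim : ∀ t, GameSim ε η (j + 1) (P t) (Q t))
    (hroot : ∀ i, cl i = none → ∃ x, e x = G.roots i ∧ e' x = H.roots i)
    {i : Fin n} {t : ι} (hi : cl i = some t) {x : (P t).V} {y : (Q t).V}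
    (hxy : GameSim ε η j ((P t).addRoot x) ((Q t).addRoot y))
    (hx : (P t).Near (2 ^ j) ((P t).roots i) x) :
    LocalSim ε η s j (G.addRoot (f t x)) (H.addRoot (g t y)) := by
  classical
  have hex : ∀ t', ∃ p : (P t').V × (Q t').V,
      GameSim ε η j ((P t').addRoot p.1) ((Q t').addRoot p.2) ∧
        ∀ h : t' = t, p = h ▸ (x, y) := by
    intro t'
    by_cases ht : t' = t
    · subst ht
      exact ⟨(x, y), hxy, fun _ => rfl⟩
    · have := hG.nonempty t'
      obtain ⟨p, q, hpq⟩ := (hsim t').exists_addRoot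
      exact ⟨(p, q), hpq, fun h => absurd h ht⟩
  choose p hp hp' using hex
  have hpt : p t = (x, y) := hp' t rfl
  have hy : (Q t).Near (2 ^ j) ((Q t).roots i) y := by
    have h1 := hxy.near (i := i.castSucc) (j := Fin.last n) (by
      rw [addRoot_roots_castSucc, addRoot_roots_last]
      exact hx)
    rw [addRoot_roots_castSucc, addRoot_roots_last] at h1
    exact h1
  have hG' := hG.addRoot_patch hi (fun t => (p t).1) (by simpa only [hpt] using hx)
  have hH' := hH.addRoot_patch hi (fun t => (p t).2) (by simpa only [hpt] using hy)
  have h1 : (p t).1 = x := by rw [hpt]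
  have h2 : (p t).2 = y := by rw [hpt]
  rw [← h1, ← h2]
  refine ⟨base, X, ι, _, _, _, e, e', f, g, hG', hH', hp, fun i => ?_⟩
  refine Fin.lastCases ?_ (fun i => ?_) i
  · simp
  · rw [Fin.snoc_castSucc, addRoot_roots_castSucc, addRoot_roots_castSucc]
    exact hroot i

lemma of_base {base : MRFG S 0} {X : Set base.V} {ι : Type} {cl : Fin n → Option ι}
    {P Q : ι → MRFG S n} {e : base.V → G.V} {e' : base.V → H.V} {f : ∀ t, (P t).V → G.V}
    {g : ∀ t, (Q t).V → H.V} (hG : Side base X cl P s (j + 1) G e f)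
    (hH : Side base X cl Q s (j + 1) H e' g) (hsim : ∀ t, GameSim ε η (j + 1) (P t) (Q t))
    (hroot : ∀ i, cl i = none → ∃ x, e x = G.roots i ∧ e' x = H.roots i)
    {x y : base.V} (hy : y ∈ X ∨ ∃ i, cl i = none ∧ e y = G.roots i)
    (hxy : base.Near (2 ^ j) y x) :
    LocalSim ε η s j (G.addRoot (e x)) (H.addRoot (e' x)) := by
  have hy' : y ∈ X ∨ ∃ i, cl i = none ∧ e' y = H.roots i := by
    refine hy.imp_right ?_
    rintro ⟨i, hi, h⟩
    obtain ⟨z, h1, h2⟩ := hroot i hi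
    obtain rfl := hG.emb_base.inj (h.trans h1.symm)
    exact ⟨i, hi, h2⟩
  have hex : ∀ t, ∃ p : (P t).V × (Q t).V,
      GameSim ε η j ((P t).addRoot p.1) ((Q t).addRoot p.2) := by
    intro t
    have := hG.nonempty t
    obtain ⟨p, q, hpq⟩ := (hsim t).exists_addRoot
    exact ⟨(p, q), hpq⟩
  choose p hp using hex
  refine ⟨base, X, ι, _, _, _, e, e', f, g, hG.addRoot_base hy hxy (fun t => (p t).1),
    hH.addRoot_base hy' hxy (fun t => (p t).2), hp, fun i => ?_⟩
  refine Fin.lastCases ?_ (fun i => ?_) i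
  · intro _
    rw [addRoot_roots_last, addRoot_roots_last]
    exact ⟨x, rfl, rfl⟩
  · rw [Fin.snoc_castSucc, addRoot_roots_castSucc, addRoot_roots_castSucc]
    exact hroot i

lemma comapRoots_zero_addRoot (P : MRFG S 1) :
    (P.comapRoots (fun _ : Fin n => 0)).addRoot (P.roots 0) =
      P.comapRoots (fun _ : Fin (n + 1) => 0) := by
  have : Fin.snoc (α := fun _ => P.V) (P.roots ∘ fun _ : Fin n => 0) (P.roots 0) =
      P.roots ∘ fun _ : Fin (n + 1) => 0 := by
    funext i
    refine Fin.lastCases ?_ (fun i => ?_) i <;> simp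
  simp only [comapRoots, addRoot, this]

/-- A new root far from the others, with neighbourhoods that are similar on both sides. -/
lemma of_newPatch {base : MRFG S 0} {X : Set base.V} {ι : Type} {cl : Fin n → Option ι}
    {P Q : ι → MRFG S n} {e : base.V → G.V} {e' : base.V → H.V} {f : ∀ t, (P t).V → G.V}
    {g : ∀ t, (Q t).V → H.V} (hG : Side base X cl P s (j + 1) G e f)
    (hH : Side base X cl Q s (j + 1) H e' g) (hsim : ∀ t, GameSim ε η (j + 1) (P t) (Q t))
    (hroot : ∀ i, cl i = none → ∃ x, e x = G.roots i ∧ e' x = H.roots i)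
    {P' Q' : MRFG S 1} (hsim' : GameSim ε η j P' Q') {f' : P'.V → G.V} {g' : Q'.V → H.V}
    (hf' : IsEmb P' G f') (hg' : IsEmb Q' H g')
    (hff' : FullNear P' G f' (2 ^ j) (P'.roots 0)) (hgg' : FullNear Q' H g' (2 ^ j) (Q'.roots 0))
    (hfar : ∀ i, ¬ G.Near (2 ^ j) (G.roots i) (f' (P'.roots 0)))
    (hfar' : ∀ i, ¬ H.Near (2 ^ j) (H.roots i) (g' (Q'.roots 0)))
    (hfarX : ∀ x ∈ X, ¬ G.Near (2 ^ j) (f' (P'.roots 0)) (e x))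
    (hfarX' : ∀ x ∈ X, ¬ H.Near (2 ^ j) (g' (Q'.roots 0)) (e' x)) :
    LocalSim ε η s j (G.addRoot (f' (P'.roots 0))) (H.addRoot (g' (Q'.roots 0))) := by
  have hex : ∀ t, ∃ p : (P t).V × (Q t).V,
      GameSim ε η j ((P t).addRoot p.1) ((Q t).addRoot p.2) := by
    intro t
    have := hG.nonempty t
    obtain ⟨p, q, hpq⟩ := (hsim t).exists_addRoot
    exact ⟨(p, q), hpq⟩
  choose p hp using hex
  have hG1 := hG.cons (P' := P'.comapRoots (fun _ => 0)) (f' := f') ⟨hf'.inj, hf'.adj, hf'.feat⟩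
    ⟨P'.roots 0⟩
  have hH1 := hH.cons (P' := Q'.comapRoots (fun _ => 0)) (f' := g') ⟨hg'.inj, hg'.adj, hg'.feat⟩
    ⟨Q'.roots 0⟩
  let x : ∀ t, (Side.consPatch P (P'.comapRoots (fun _ => 0)) t).V := fun t =>
    match t with
    | none => P'.roots 0
    | some t => (p t).1
  let y : ∀ t, (Side.consPatch Q (Q'.comapRoots (fun _ => 0)) t).V := fun t =>
    match t with
    | none => Q'.roots 0
    | some t => (p t).2
  have hG2 := hG1.addRoot (some none) (f' (P'.roots 0)) x
    (by
      rintro t ht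
      obtain rfl := Option.some.inj ht
      exact ⟨rfl, hff'⟩)
    (fun i _ => hfar i) (fun _ _ => hfarX)
  have hH2 := hH1.addRoot (some none) (g' (Q'.roots 0)) y
    (by
      rintro t ht
      obtain rfl := Option.some.inj ht
      exact ⟨rfl, hgg'⟩)
    (fun i _ => hfar' i) (fun _ _ => hfarX')
  refine ⟨base, X, Option ι, _, _, _, e, e', _, _, hG2, hH2, ?_, fun i => ?_⟩
  · rintro (_ | t)
    · have := hsim'.comapRoots (fun _ : Fin (n + 1) => 0)
      rwa [← comapRoots_zero_addRoot, ← comapRoots_zero_addRoot] at this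
    · exact hp t
  · refine Fin.lastCases ?_ (fun i => ?_) i
    · simp
    · rw [Fin.snoc_castSucc, addRoot_roots_castSucc, addRoot_roots_castSucc]
      intro hi
      exact hroot i (by simpa using hi)

/-! #### The moves of the game -/

lemma disjUnion (h : LocalSim ε η s (j + 1) G H) (hε : 0 ≤ ε) (hη : 0 ≤ η) {T : MRFG S 1}
    (hT : T.graph.IsAcyclic) : LocalSim ε η s j (G.disjUnion T) (H.disjUnion T) := by
  obtain ⟨base, X, ι, cl, P, Q, e, e', f, g, hG, hH, hsim, hroot⟩ := h
  rw [disjUnion_eq, disjUnion_eq]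
  exact of_newPatch (hG.sumRight hT) (hH.sumRight hT) hsim
    (fun i hi => by
      obtain ⟨x, h1, h2⟩ := hroot i hi
      exact ⟨x, congrArg Sum.inl h1, congrArg Sum.inl h2⟩)
    (GameSim.refl T hε hη) (isEmb_inr G T) (isEmb_inr H T)
    (fun _ _ y _ => fullAt_inr G T y) (fun _ _ y _ => fullAt_inr H T y)
    (fun i => not_near_inl_inr G T _ _ _) (fun i => not_near_inl_inr H T _ _ _)
    (fun x _ h => not_near_inl_inr G T _ _ _ h.symm)
    (fun x _ h => not_near_inl_inr H T _ _ _ h.symm)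

lemma exists_reply (h : LocalSim ε η s (j + 1) G H) (hε : 0 ≤ ε) (hη : 0 ≤ η) (hs : 2 ^ j ≤ s)
    (p : G.V) :
    (∃ q, LocalSim ε η s j (G.addRoot p) (H.addRoot q)) ∨
      ∃ T : MRFG S 1, T.IsFiniteRootedTree ∧
        LocalSim ε η s j (G.addRoot p) (H.disjUnion T) := by
  obtain ⟨base, X, ι, cl, P, Q, e, e', f, g, hG, hH, hsim, hroot⟩ := h
  by_cases h1 : ∃ i t, cl i = some t ∧ G.Near (2 ^ j) (G.roots i) p
  · obtain ⟨i, t, hi, hp⟩ := h1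
    rw [← hG.roots_eq i t hi] at hp
    obtain ⟨x, rfl, hx⟩ := (hG.emb t).exists_of_near ((hG.full i t hi).mono
      (Nat.pow_le_pow_right (by norm_num) (by omega))) hp
    obtain ⟨y, hxy⟩ := (gameSim_succ.1 (hsim t)).1 x
    exact Or.inl ⟨_, of_patch hG hH hsim hroot hi hxy hx⟩
  by_cases h2 : ∃ y, (y ∈ X ∨ ∃ i, cl i = none ∧ e y = G.roots i) ∧ G.Near (2 ^ j) (e y) p
  · obtain ⟨y, hy, hp⟩ := h2
    obtain ⟨x, rfl, hx⟩ := hG.emb_base.exists_of_near (fun _ _ z _ => hG.full_base z) hp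
    exact Or.inl ⟨_, of_base hG hH hsim hroot hy hx⟩
  right
  push Not at h1 h2
  obtain ⟨T, hT, f', hf', rfl, hff'⟩ := hG.tree p fun x hx hxp => h2 x (Or.inl hx) (by simp [hxp])
  refine ⟨T, hT, ?_⟩
  rw [disjUnion_eq]
  refine of_newPatch hG (hH.sumRight hT.2.isAcyclic) hsim
    (fun i hi => by
      obtain ⟨x, h1, h2⟩ := hroot i hi
      exact ⟨x, h1, congrArg Sum.inl h2⟩)
    (GameSim.refl T hε hη) hf' (isEmb_inr H T) (hff'.mono hs) (fun _ _ y _ => fullAt_inr H T y)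
    ?_ (fun i => not_near_inl_inr H T _ _ _) ?_ (fun x _ h => not_near_inl_inr H T _ _ _ h.symm)
  · intro i hn
    rcases hi : cl i with _ | t
    · obtain ⟨x, hx, -⟩ := hroot i hi
      exact h2 x (Or.inr ⟨i, hi, hx⟩) (by rwa [hx])
    · exact h1 i t hi hn
  · exact fun x hx hn => h2 x (Or.inl hx) hn.symm

lemma nbrs_eq_empty_iff_and_coupled (h : LocalSim ε η s (j + 1) G H) (hη : 0 ≤ η) (i : Fin n) :
    (G.nbrs (G.roots i) = ∅ ↔ H.nbrs (H.roots i) = ∅) ∧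
    (G.nbrs (G.roots i) ≠ ∅ → H.nbrs (H.roots i) ≠ ∅ →
      Coupled (G.nbrs (G.roots i)) (H.nbrs (H.roots i))
        (fun v u => LocalSim ε η s j (G.addRoot v) (H.addRoot u)) η) := by
  obtain ⟨base, X, ι, cl, P, Q, e, e', f, g, hG, hH, hsim, hroot⟩ := h
  rcases hi : cl i with _ | t
  · obtain ⟨x, h1, h2⟩ := hroot i hi
    rw [← h1, ← h2, hG.emb_base.nbrs_eq (hG.full_base x), hH.emb_base.nbrs_eq (hH.full_base x),
      Finset.map_eq_empty, Finset.map_eq_empty]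
    refine ⟨Iff.rfl, fun hne _ => (Coupled.refl (Finset.map_nonempty.1
      (Finset.nonempty_iff_ne_empty.2 hne)) hη).map _ _ ?_⟩
    rintro a ha _ _ rfl
    exact of_base hG hH hsim hroot (Or.inr ⟨i, hi, h1⟩)
      (near_of_adj (mem_nbrs.1 ha) Nat.one_le_two_pow)
  · have h0 : ∀ l : ℕ, 0 < 2 ^ l := fun l => by positivity
    rw [← hG.roots_eq i t hi, ← hH.roots_eq i t hi,
      (hG.emb t).nbrs_eq (hG.full i t hi 0 (h0 _) _ (by simp)),
      (hH.emb t).nbrs_eq (hH.full i t hi 0 (h0 _) _ (by simp)),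
      Finset.map_eq_empty, Finset.map_eq_empty]
    have h1 := (gameSim_succ.1 (hsim t)).2.2 i
    refine ⟨h1.1, fun h2 h3 => (h1.2 (mt (by simp) h2) (mt (by simp) h3)).map _ _ fun a ha b _ hab => ?_⟩
    exact of_patch hG hH hsim hroot hi hab (near_of_adj (mem_nbrs.1 ha) Nat.one_le_two_pow)

lemma gameSim_zero (h : LocalSim ε η s j G H) (hε : 0 ≤ ε) : GameSim ε η 0 G H := by
  obtain ⟨base, X, ι, cl, P, Q, e, e', f, g, hG, hH, hsim, hroot⟩ := h
  have hfar : ∀ {K : MRFG S n} {a b : K.V}, ¬ K.Near (2 ^ j) a b → a ≠ b ∧ ¬ K.graph.Adj a b :=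
    fun hn => ⟨fun hab => hn (by simp [hab]), fun hab => hn (near_of_adj hab Nat.one_le_two_pow)⟩
  have h0 : ∀ t, GameSim ε η 0 (P t) (Q t) := fun t => by
    have := hG.nonempty t
    exact (hsim t).mono (Nat.zero_le j)
  have key : ∀ i i', (G.roots i = G.roots i' ↔ H.roots i = H.roots i') ∧
      (G.graph.Adj (G.roots i) (G.roots i') ↔ H.graph.Adj (H.roots i) (H.roots i')) := by
    intro i i'
    by_cases hii : cl i = cl i'
    · rcases hi : cl i with _ | t
      · obtain ⟨x, h1, h2⟩ := hroot i hi
        obtain ⟨y, h3, h4⟩ := hroot i' (by rw [← hii, hi])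
        rw [← h1, ← h2, ← h3, ← h4, hG.emb_base.adj, hH.emb_base.adj, hG.emb_base.inj.eq_iff,
          hH.emb_base.inj.eq_iff]
        exact ⟨Iff.rfl, Iff.rfl⟩
      · have hi' : cl i' = some t := by rw [← hii, hi]
        rw [← hG.roots_eq i t hi, ← hG.roots_eq i' t hi', ← hH.roots_eq i t hi,
          ← hH.roots_eq i' t hi', (hG.emb t).adj, (hH.emb t).adj, (hG.emb t).inj.eq_iff,
          (hH.emb t).inj.eq_iff]
        exact ⟨(h0 t).1 i i', (h0 t).2.1 i i'⟩
    · have h1 := hfar (hG.far i i' hii)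
      have h2 := hfar (hH.far i i' hii)
      simp [h1, h2]
  refine ⟨fun i i' => (key i i').1, fun i i' => (key i i').2, fun i => ?_⟩
  rcases hi : cl i with _ | t
  · obtain ⟨x, h1, h2⟩ := hroot i hi
    rw [← h1, ← h2, hG.emb_base.feat, hH.emb_base.feat]
    simpa using hε
  · rw [← hG.roots_eq i t hi, ← hH.roots_eq i t hi, (hG.emb t).feat, (hH.emb t).feat]
    exact (h0 t).2.2 i

/-! #### Instances -/

/-- Adding trees that are similar near their roots. -/
lemma disjUnion_disjUnion (G : MRFG S n) {T T' P Q : MRFG S 1} (hT : T.graph.IsAcyclic)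
    (hT' : T'.graph.IsAcyclic) (hsim : GameSim ε η j P Q) {f : P.V → T.V} {g : Q.V → T'.V}
    (hf : IsEmb P T f) (hg : IsEmb Q T' g) (hf0 : f (P.roots 0) = T.roots 0)
    (hg0 : g (Q.roots 0) = T'.roots 0) (hff : FullNear P T f (2 ^ j) (P.roots 0))
    (hgg : FullNear Q T' g (2 ^ j) (Q.roots 0)) (s : ℕ) :
    LocalSim ε η s j (G.disjUnion T) (G.disjUnion T') := by
  rw [disjUnion_eq, disjUnion_eq, ← hf0, ← hg0]
  exact of_newPatch (f' := Sum.inr ∘ f) (g' := Sum.inr ∘ g)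
    ((refl_side G s (j + 1)).sumRight hT) ((refl_side G s (j + 1)).sumRight hT')
    (fun t => t.elim) (fun i _ => ⟨G.roots i, rfl, rfl⟩) hsim
    ((isEmb_inr G T).comp hf) ((isEmb_inr G T').comp hg)
    (fun l hl y hy => FullAt.comp (isEmb_inr G T) (fullAt_inr G T _) (hff l hl y hy))
    (fun l hl y hy => FullAt.comp (isEmb_inr G T') (fullAt_inr G T' _) (hgg l hl y hy))
    (fun i => not_near_inl_inr G T _ _ _) (fun i => not_near_inl_inr G T' _ _ _)
    (fun x _ h => not_near_inl_inr G T _ _ _ h.symm)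
    (fun x _ h => not_near_inl_inr G T' _ _ _ h.symm)

/-- A vertex far from the roots and from short cycles, compared to the root of a tree. -/
lemma addRoot_disjUnion {R : ℕ} (hR : 2 ^ j ≤ R) {v : G.V} {T Q : MRFG S 1}
    (hT : T.graph.IsAcyclic) (hsim : GameSim ε η j (G.ball R v) Q) {g : Q.V → T.V}
    (hg : IsEmb Q T g) (hg0 : g (Q.roots 0) = T.roots 0)
    (hgg : FullNear Q T g (2 ^ j) (Q.roots 0))
    (hroots : ∀ i, ¬ G.Near (2 ^ j) (G.roots i) v)
    (hcycle : ∀ u, G.OnShortCycle (2 * s + 1) u → ¬ G.Near (2 ^ j + s) v u) :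
    LocalSim ε η s j (G.addRoot v) (G.disjUnion T) := by
  rw [disjUnion_eq, ← hg0]
  refine of_newPatch (f' := Subtype.val) (g' := Sum.inr ∘ g)
    (refl_side G s (j + 1)) ((refl_side G s (j + 1)).sumRight hT)
    (fun t => t.elim) (fun i _ => ⟨G.roots i, rfl, rfl⟩) hsim
    (isEmb_ball G R v) ((isEmb_inr G T).comp hg)
    ((fullNear_ball G R v).mono hR)
    (fun l hl y hy => FullAt.comp (isEmb_inr G T) (fullAt_inr G T _) (hgg l hl y hy))
    hroots (fun i => not_near_inl_inr G T _ _ _) ?_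
    (fun x _ h => not_near_inl_inr G T _ _ _ h.symm)
  intro x hx hn
  by_cases hac : (G.ball s x).graph.IsAcyclic
  · exact hx (hasTree_of_isAcyclic_ball hac)
  · obtain ⟨u, hu, hc⟩ := exists_short_cycle_of_not_isAcyclic_ball hac
    exact hcycle u hc (Near.trans (G := G) hn hu)

end LocalSim

/-! ### Lipschitz constants, averages and suprema -/

lemma lipschitzWith_lipConst {m : ℕ} {F : (Fin m → ℝ) → ℝ} (hF : ∃ L : ℝ≥0, LipschitzWith L F) :
    LipschitzWith (lipConst F) F := by
  refine LipschitzWith.of_dist_le_mul fun x y => ?_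
  rcases eq_or_ne x y with rfl | hxy
  · simp
  have hpos : 0 < nndist x y := by
    rw [pos_iff_ne_zero, Ne, nndist_eq_zero]
    exact hxy
  have h1 : nndist (F x) (F y) / nndist x y ≤ lipConst F := by
    refine le_csInf hF fun L hL => ?_
    rw [div_le_iff₀ hpos]
    exact hL.nndist_le x y
  rw [div_le_iff₀ hpos] at h1
  exact_mod_cast h1

lemma abs_app_sub_le {m : ℕ} {F : (Fin m → ℝ) → ℝ} (hF : ∃ L : ℝ≥0, LipschitzWith L F)
    {x y : Fin m → ℝ} {δ : ℝ} (hδ : 0 ≤ δ) {s : Fin m → ℝ≥0} (h : ∀ i, |x i - y i| ≤ δ * s i) :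
    |F x - F y| ≤ δ * ((Finset.univ.sup fun i => lipConst F * s i : ℝ≥0) : ℝ) := by
  have h1 := (lipschitzWith_lipConst hF).dist_le_mul x y
  rw [Real.dist_eq] at h1
  rcases eq_or_lt_of_le (zero_le (a := lipConst F)) with h0 | h0
  · rw [← h0] at h1
    simp only [NNReal.coe_zero, zero_mul] at h1
    exact h1.trans (by positivity)
  have h0' : (0 : ℝ) < lipConst F := h0
  refine h1.trans ?_
  rw [← le_div_iff₀' h0', dist_pi_le_iff (by positivity)]
  intro i
  rw [Real.dist_eq, le_div_iff₀ h0']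
  have h2 : lipConst F * s i ≤ Finset.univ.sup fun i => lipConst F * s i :=
    Finset.le_sup (f := fun i => lipConst F * s i) (Finset.mem_univ i)
  have h3 : (lipConst F : ℝ) * s i ≤ ((Finset.univ.sup fun i => lipConst F * s i : ℝ≥0) : ℝ) := by
    exact_mod_cast h2
  calc |x i - y i| * lipConst F ≤ δ * s i * lipConst F := by
        have := h i
        gcongr
    _ = δ * (lipConst F * s i) := by ring
    _ ≤ _ := by gcongr

lemma abs_average_le {α : Type*} {A : Finset α} {f : α → ℝ} {C : ℝ} (hC : 0 ≤ C)
    (h : ∀ a ∈ A, |f a| ≤ C) : |(∑ a ∈ A, f a) / A.card| ≤ C := by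
  rw [abs_div, Nat.abs_cast]
  refine div_le_of_le_mul₀ (by positivity) hC ?_
  refine (Finset.abs_sum_le_sum_abs _ _).trans ((Finset.sum_le_sum h).trans ?_)
  simp [mul_comm]

lemma abs_sSup_le {A : Set ℝ} {C : ℝ} (hC : 0 ≤ C) (h : ∀ a ∈ A, |a| ≤ C) : |sSup A| ≤ C := by
  rcases A.eq_empty_or_nonempty with rfl | ⟨a, ha⟩
  · simpa using hC
  · have hbdd : BddAbove A := ⟨C, fun b hb => (le_abs_self b).trans (h b hb)⟩
    rw [abs_le]
    exact ⟨(neg_le_of_abs_le (h a ha)).trans (le_csSup hbdd ha),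
      csSup_le ⟨a, ha⟩ fun b hb => (le_abs_self b).trans (h b hb)⟩

lemma sSup_le_sSup_add {A B : Set ℝ} {δ : ℝ} (hA : A.Nonempty) (hB : BddAbove B)
    (h : ∀ a ∈ A, ∃ b ∈ B, a ≤ b + δ) : sSup A ≤ sSup B + δ := by
  refine csSup_le hA fun a ha => ?_
  obtain ⟨b, hb, hab⟩ := h a ha
  linarith [le_csSup hB hb]

lemma abs_sSup_sub_le {A B : Set ℝ} {δ : ℝ} (hδ : 0 ≤ δ) (hA : BddAbove A) (hB : BddAbove B)
    (h : ∀ a ∈ A, ∃ b ∈ B, |a - b| ≤ δ) (h' : ∀ b ∈ B, ∃ a ∈ A, |b - a| ≤ δ) :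
    |sSup A - sSup B| ≤ δ := by
  rcases A.eq_empty_or_nonempty with rfl | hne
  · rcases B.eq_empty_or_nonempty with rfl | ⟨b, hb⟩
    · simpa using hδ
    · obtain ⟨a, ha, -⟩ := h' b hb
      exact ha.elim
  · have hne' : B.Nonempty := by
      obtain ⟨a, ha⟩ := hne
      obtain ⟨b, hb, -⟩ := h a ha
      exact ⟨b, hb⟩
    have h1 := sSup_le_sSup_add hne hB (δ := δ) fun a ha => by
      obtain ⟨b, hb, hab⟩ := h a ha
      exact ⟨b, hb, by linarith [le_abs_self (a - b)]⟩
    have h2 := sSup_le_sSup_add hne' hA (δ := δ) fun b hb => by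
      obtain ⟨a, ha, hab⟩ := h' b hb
      exact ⟨a, ha, by linarith [le_abs_self (b - a)]⟩
    rw [abs_le]
    constructor <;> linarith

/-! ### The branching process -/

section Fbp

variable {ω ω' : Env S} {r k : ℕ} {ε η : ℝ}

lemma isAcyclic_fbpTree (ω : Env S) : (fbpTree ω).graph.IsAcyclic := by
  refine isAcyclic_of_height (fun a : (fbpTree ω).V => a.1.length) ?_ ?_
  · rintro a b (⟨i, h⟩ | ⟨i, h⟩) <;> have := congrArg List.length h <;> simp at this <;> omega
  · rintro w a b (⟨i, h⟩ | ⟨i, h⟩) hb ha' hb'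
    · have := congrArg List.length h
      simp at this
      omega
    · rcases hb with ⟨i', h'⟩ | ⟨i', h'⟩
      · have := congrArg List.length h'
        simp at this
        omega
      · exact Subtype.ext (List.cons.inj (h.symm.trans h')).2

lemma near_fbpTree_root_iff {a : (fbpTree ω).V} :
    (fbpTree ω).Near r ((fbpTree ω).roots 0) a ↔ a.1.length ≤ r := by
  constructor
  · induction r generalizing a with
    | zero =>
      intro h
      rw [near_zero_iff] at h
      rw [← h]
      rfl
    | succ r ih =>
      intro h
      rcases h.succ_cases with h | ⟨b, h, hab⟩
      · exact (ih h).trans (Nat.le_succ r)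
      · have := ih h
        rcases hab with ⟨i, h⟩ | ⟨i, h⟩ <;> have := congrArg List.length h <;> simp at this <;> omega
  · obtain ⟨l, hl⟩ := a
    induction l generalizing r with
    | nil => exact fun _ => near_self _ _ _
    | cons i l ih =>
      intro h
      simp only [List.length_cons] at h
      obtain ⟨r, rfl⟩ := Nat.exists_eq_add_of_le' (le_of_add_le_right h)
      have h1 : (fbpTree ω).Near r ((fbpTree ω).roots 0) ⟨l, hl.1⟩ :=
        ih hl.1 (Nat.le_of_succ_le_succ h)
      have h2 : (fbpTree ω).graph.Adj ⟨l, hl.1⟩ ⟨i :: l, hl⟩ := Or.inl ⟨i, rfl⟩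
      exact h1.trans (near_of_adj h2 le_rfl)

lemma born_congr (h : ∀ l, Born ω l → l.length ≤ r → (ω' l).1 = (ω l).1) {l : List ℕ}
    (hl : l.length ≤ r) : Born ω l ↔ Born ω' l := by
  induction l with
  | nil => exact Iff.rfl
  | cons i l ih =>
    simp only [List.length_cons] at hl
    have h1 := ih (by omega)
    constructor
    · rintro ⟨h2, h3⟩
      exact ⟨h1.1 h2, by rwa [h l h2 (by omega)]⟩
    · rintro ⟨h2, h3⟩
      have h2' := h1.2 h2
      exact ⟨h2', by rwa [← h l h2' (by omega)]⟩

/-- The first generations depend only on finitely many coordinates of the sample, and continuously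
on their features. -/
lemma gameSim_fbpTrunc (hη : 0 ≤ η) (h : ∀ l, Born ω l → l.length ≤ r →
    (ω' l).1 = (ω l).1 ∧ ‖((ω l).2 : Fin d → ℝ) - (ω' l).2‖ ≤ ε) :
    GameSim ε η k (fbpTrunc r ω) (fbpTrunc r ω') := by
  have hb : ∀ {l : List ℕ}, l.length ≤ r → (Born ω l ↔ Born ω' l) := fun hl =>
    born_congr (fun l h1 h2 => (h l h1 h2).1) hl
  have hlen : ∀ a : (fbpTrunc r ω).V, a.1.1.length ≤ r := fun a => near_fbpTree_root_iff.1 a.2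
  have hlen' : ∀ a : (fbpTrunc r ω').V, a.1.1.length ≤ r := fun a => near_fbpTree_root_iff.1 a.2
  let e : (fbpTrunc r ω).V ≃ (fbpTrunc r ω').V :=
    { toFun := fun a => ⟨⟨a.1.1, (hb (hlen a)).1 a.1.2⟩, near_fbpTree_root_iff.2 (hlen a)⟩
      invFun := fun a => ⟨⟨a.1.1, (hb (hlen' a)).2 a.1.2⟩, near_fbpTree_root_iff.2 (hlen' a)⟩
      left_inv := fun _ => rfl
      right_inv := fun _ => rfl }
  exact GameSim.of_iso hη e (fun _ _ => Iff.rfl) (fun _ => rfl)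
    (fun a => (h a.1.1 a.1.2 (hlen a)).2)

lemma finite_born (ω : Env S) (r : ℕ) : {l | Born ω l ∧ l.length ≤ r}.Finite := by
  refine (((fbpTree ω).finite_near r ((fbpTree ω).roots 0)).image Subtype.val).subset ?_
  rintro l ⟨h1, h2⟩
  exact ⟨⟨l, h1⟩, near_fbpTree_root_iff.2 h2, rfl⟩

lemma eventually_gameSim_fbpTrunc (ω : Env S) (r k : ℕ) (hε : 0 < ε) (hη : 0 ≤ η) :
    ∀ᶠ ω' in nhds ω, GameSim ε η k (fbpTrunc r ω) (fbpTrunc r ω') := by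
  have h1 : ∀ l ∈ {l | Born ω l ∧ l.length ≤ r}, ∀ᶠ ω' : Env S in nhds ω,
      (ω' l).1 = (ω l).1 ∧ ‖((ω l).2 : Fin d → ℝ) - (ω' l).2‖ ≤ ε := by
    intro l _
    refine Filter.Eventually.and ?_ ?_
    · have hc : Continuous fun ω' : Env S => (ω' l).1 := by fun_prop
      exact hc.continuousAt.eventually (eventually_nhds_iff.2
        ⟨{(ω l).1}, fun _ h => h, isOpen_discrete _, rfl⟩)
    · have hc : Continuous fun ω' : Env S => ‖((ω l).2 : Fin d → ℝ) - (ω' l).2‖ := by fun_prop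
      exact (hc.continuousAt.eventually_lt continuousAt_const (by simpa using hε)).mono
        fun _ h => le_of_lt h
  have h2 := (Filter.eventually_all_finite (finite_born ω r)).2 h1
  exact h2.mono fun ω' h => gameSim_fbpTrunc hη fun l hl hr => h l ⟨hl, hr⟩

end Fbp

/-! ### Bounds on controllers -/

section Controller

variable {n : ℕ} (c : ℝ≥0) (D : Measure S) [IsProbabilityMeasure D]

instance : IsProbabilityMeasure (fbpMeasure c D) := by
  unfold fbpMeasure
  infer_instance

lemma exists_abs_controller_le (hS : IsCompact S) (τ : Term d n) :
    ∃ M : ℝ, 0 ≤ M ∧ ∀ G : MRFG S n, |controller c D τ G| ≤ M := by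
  induction τ with
  | const a => exact ⟨|a|, abs_nonneg a, fun G => le_rfl⟩
  | val i j =>
    obtain ⟨R, hR⟩ := hS.isBounded.exists_norm_le
    refine ⟨max R 0, le_max_right _ _, fun G => ?_⟩
    rw [controller]
    exact ((norm_le_pi_norm _ i).trans (hR _ (G.feat (G.roots j)).2)).trans (le_max_left _ _)
  | edge i j =>
    refine ⟨1, zero_le_one, fun G => ?_⟩
    rw [controller]
    split_ifs <;> simp
  | eq i j =>
    refine ⟨1, zero_le_one, fun G => ?_⟩
    rw [controller]
    split_ifs <;> simp
  | app F hF args ih =>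
    obtain ⟨L, hL⟩ := hF
    choose M hM0 hM using ih
    refine ⟨|F 0| + L * ∑ i, M i, by have := Finset.sum_nonneg fun i (_ : i ∈ Finset.univ) => hM0 i
                                     positivity, fun G => ?_⟩
    rw [controller]
    have h1 := hL.dist_le_mul (fun i => controller c D (args i) G) 0
    rw [Real.dist_eq] at h1
    have h2 : dist (fun i => controller c D (args i) G) 0 ≤ ∑ i, M i := by
      rw [dist_pi_le_iff (Finset.sum_nonneg fun i _ => hM0 i)]
      intro i
      rw [Real.dist_eq, Pi.zero_apply, sub_zero]
      exact (hM i G).trans (Finset.single_le_sum (fun i _ => hM0 i) (Finset.mem_univ i))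
    have h3 := mul_le_mul_of_nonneg_left h2 L.coe_nonneg
    have h4 := abs_sub_abs_le_abs_sub (F fun i => controller c D (args i) G) (F 0)
    linarith
  | mean body ih =>
    obtain ⟨M, hM0, hM⟩ := ih
    refine ⟨M, hM0, fun G => ?_⟩
    rw [controller]
    have := norm_integral_le_of_norm_le_const (μ := fbpMeasure c D) (C := M)
      (f := fun ω => controller c D body (G.disjUnion (fbpTree ω))) (Filter.Eventually.of_forall fun ω => hM (G.disjUnion (fbpTree ω)))
    simpa using this
  | lmean i body ih =>
    obtain ⟨M, hM0, hM⟩ := ih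
    refine ⟨M, hM0, fun G => ?_⟩
    rw [controller]
    split_ifs
    · simpa using hM0
    · exact abs_average_le hM0 fun v _ => hM _
  | sup body ih =>
    obtain ⟨M, hM0, hM⟩ := ih
    refine ⟨M, hM0, fun G => ?_⟩
    rw [controller]
    refine abs_sSup_le hM0 ?_
    rintro _ (⟨v, rfl⟩ | ⟨T, -, rfl⟩) <;> exact hM _

/-- The set whose supremum is the controller of a supremum. -/
def supValues (π : Term d (n + 1)) (G : MRFG S n) : Set ℝ :=
  {x | ∃ v : G.V, x = controller c D π (G.addRoot v)} ∪
    {x | ∃ T : MRFG S 1, T.IsFiniteRootedTree ∧ x = controller c D π (G.disjUnion T)}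

lemma controller_sup (π : Term d (n + 1)) (G : MRFG S n) :
    controller c D (.sup π) G = sSup (supValues c D π G) := by
  rw [controller, supValues]

lemma bddAbove_supValues (hS : IsCompact S) (π : Term d (n + 1)) (G : MRFG S n) :
    BddAbove (supValues c D π G) := by
  obtain ⟨M, -, hM⟩ := exists_abs_controller_le c D hS π
  refine ⟨M, ?_⟩
  rintro _ (⟨v, rfl⟩ | ⟨T, -, rfl⟩) <;> exact (le_abs_self _).trans (hM _)

end Controller

/-! ### Controllers of locally similar graphs -/

section Compare

variable {n : ℕ} (c : ℝ≥0) (D : Measure S) [IsProbabilityMeasure D]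

open Classical in
lemma abs_ite_sub_ite {p q : Prop} (h : p ↔ q) :
    |(if p then (1 : ℝ) else 0) - if q then 1 else 0| = 0 := by
  by_cases hp : p
  · rw [if_pos hp, if_pos (h.1 hp), sub_self, abs_zero]
  · rw [if_neg hp, if_neg (mt h.2 hp), sub_self, abs_zero]

/-- Locally similar graphs from a class `𝓕` have close controllers. The class is closed under the
moves of the game, up to replacing the branching process by other trees. -/
lemma abs_controller_sub_le (hS : IsCompact S) {ε η : ℝ} (hε : 0 ≤ ε) (hη : 0 ≤ η)
    (𝓕 : ∀ n, MRFG S n → Prop)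
    (hadd : ∀ n (G : MRFG S n) v, 𝓕 n G → 𝓕 (n + 1) (G.addRoot v))
    (htree : ∀ n (G : MRFG S n) T, T.IsFiniteRootedTree → 𝓕 n G → 𝓕 (n + 1) (G.disjUnion T))
    (τ : Term d n)
    (hint : ∀ m (π : Term d (m + 1)), Subterm (.mean π) τ → ∀ G : MRFG S m,
      Integrable (fun ω => controller c D π (G.disjUnion (fbpTree ω))) (fbpMeasure c D))
    (hfbp : ∀ m (π : Term d (m + 1)), Subterm (.mean π) τ → ∀ ω : Env S, ∃ T : MRFG S 1,
      T.graph.IsAcyclic ∧ ∀ G, 𝓕 m G → 𝓕 (m + 1) (G.disjUnion T) ∧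
        controller c D π (G.disjUnion (fbpTree ω)) = controller c D π (G.disjUnion T))
    (hbd : ∀ m (σ : Term d m), Subterm σ τ → ∃ C, 0 ≤ C ∧ C * η ≤ ε / 4 ∧
      ∀ G, 𝓕 m G → |controller c D σ G| ≤ C)
    {s j : ℕ} (hrank : τ.rank ≤ j) (hs : 2 ^ j ≤ 2 * s + 1) {G H : MRFG S n}
    (hG : 𝓕 n G) (hH : 𝓕 n H) (hsim : LocalSim ε η s j G H) :
    |controller c D τ G - controller c D τ H| ≤ ε * τ.slope := by
  induction τ generalizing j with
  | const a => simp [controller, Term.slope]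
  | val i k =>
    have := (hsim.gameSim_zero hε).2.2 k
    simp only [controller, Term.slope, NNReal.coe_one, mul_one]
    exact (norm_le_pi_norm ((G.feat (G.roots k)).1 - (H.feat (H.roots k)).1) i).trans this
  | edge i k =>
    have := (hsim.gameSim_zero hε).2.1 i k
    rw [controller, controller]
    exact (le_of_eq (abs_ite_sub_ite this)).trans (by positivity)
  | eq i k =>
    have := (hsim.gameSim_zero hε).1 i k
    rw [controller, controller]
    exact (le_of_eq (abs_ite_sub_ite this)).trans (by positivity)
  | app F hF args ih =>
    rw [controller, controller, Term.slope]
    refine abs_app_sub_le hF hε fun i => ?_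
    rw [Term.rank, Finset.sup_le_iff] at hrank
    exact ih i (fun m π h => hint m π (.app i h)) (fun m π h => hfbp m π (.app i h))
      (fun m σ h => hbd m σ (.app i h)) (hrank i (Finset.mem_univ i)) hs hG hH hsim
  | mean body ih =>
    obtain ⟨j, rfl⟩ := Nat.exists_eq_add_of_le' (show 1 ≤ j by simp only [Term.rank] at hrank; omega)
    rw [Term.rank, Nat.add_le_add_iff_right] at hrank
    rw [pow_succ] at hs
    have key : ∀ ω, ‖controller c D body (G.disjUnion (fbpTree ω)) -
        controller c D body (H.disjUnion (fbpTree ω))‖ ≤ ε * body.slope := by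
      intro ω
      obtain ⟨T, hT, h⟩ := hfbp _ body .refl ω
      rw [(h G hG).2, (h H hH).2]
      exact ih (fun m π h => hint m π (.mean h)) (fun m π h => hfbp m π (.mean h))
        (fun m σ h => hbd m σ (.mean h)) hrank (by omega) (h G hG).1 (h H hH).1
        (hsim.disjUnion hε hη hT)
    rw [controller, controller, ← integral_sub (hint _ body .refl G) (hint _ body .refl H)]
    have h1 := norm_integral_le_of_norm_le_const (μ := fbpMeasure c D)
      (Filter.Eventually.of_forall key)
    rw [probReal_univ, mul_one] at h1
    refine h1.trans ?_
    simp only [Term.slope, NNReal.coe_add, NNReal.coe_one]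
    nlinarith
  | lmean i body ih =>
    obtain ⟨j, rfl⟩ := Nat.exists_eq_add_of_le' (show 1 ≤ j by simp only [Term.rank] at hrank; omega)
    rw [Term.rank, Nat.add_le_add_iff_right] at hrank
    rw [pow_succ] at hs
    obtain ⟨h1, h2⟩ := hsim.nbrs_eq_empty_iff_and_coupled hη i
    obtain ⟨C, hC0, hC, hbC⟩ := hbd _ body (.lmean .refl)
    rw [controller, controller]
    by_cases h0 : G.nbrs (G.roots i) = ∅
    · rw [if_pos h0, if_pos (h1.1 h0)]
      simp only [sub_self, abs_zero]
      positivity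
    · have h0' := mt h1.2 h0
      rw [if_neg h0, if_neg h0']
      refine ((h2 h0 h0').abs_average_sub_le (Finset.nonempty_iff_ne_empty.2 h0)
        (δ := ε * body.slope) (by positivity) hC0 (fun v _ u _ hvu => ?_)
        (fun v _ => hbC _ (hadd _ _ _ hG)) (fun u _ => hbC _ (hadd _ _ _ hH))).trans ?_
      · exact ih (fun m π h => hint m π (.lmean h)) (fun m π h => hfbp m π (.lmean h))
          (fun m σ h => hbd m σ (.lmean h)) hrank (by omega) (hadd _ _ _ hG) (hadd _ _ _ hH) hvu
      · simp only [Term.slope, NNReal.coe_add, NNReal.coe_one]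
        nlinarith
  | sup body ih =>
    obtain ⟨j, rfl⟩ := Nat.exists_eq_add_of_le' (show 1 ≤ j by simp only [Term.rank] at hrank; omega)
    rw [Term.rank, Nat.add_le_add_iff_right] at hrank
    rw [pow_succ] at hs
    have key : ∀ {G H : MRFG S _}, 𝓕 _ G → 𝓕 _ H → LocalSim ε η s (j + 1) G H →
        ∀ a ∈ supValues c D body G, ∃ b ∈ supValues c D body H, |a - b| ≤ ε * body.slope := by
      intro G H hG hH hsim
      have ih' := @ih (fun m π h => hint m π (.sup h)) (fun m π h => hfbp m π (.sup h))
        (fun m σ h => hbd m σ (.sup h)) j hrank (by omega)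
      rintro _ (⟨v, rfl⟩ | ⟨T, hT, rfl⟩)
      · rcases hsim.exists_reply hε hη (by omega) v with ⟨u, hu⟩ | ⟨T, hT, hu⟩
        · exact ⟨_, Or.inl ⟨u, rfl⟩, ih' (hadd _ _ _ hG) (hadd _ _ _ hH) hu⟩
        · exact ⟨_, Or.inr ⟨T, hT, rfl⟩, ih' (hadd _ _ _ hG) (htree _ _ _ hT hH) hu⟩
      · exact ⟨_, Or.inr ⟨T, hT, rfl⟩, ih' (htree _ _ _ hT hG) (htree _ _ _ hT hH)
          (hsim.disjUnion hε hη hT.2.isAcyclic)⟩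
    rw [controller_sup, controller_sup, Term.slope]
    exact abs_sSup_sub_le (by positivity) (bddAbove_supValues c D hS body G)
      (bddAbove_supValues c D hS body H) (key hG hH hsim) (key hH hG hsim.symm)

/-- The controller depends continuously on the sample of an attached branching process. -/
lemma continuous_controller_fbpTree {j s : ℕ} (τ : Term d (n + 1))
    (h : ∀ ε : ℝ, 0 ≤ ε → ∀ G H : MRFG S (n + 1), LocalSim ε 0 s j G H →
      |controller c D τ G - controller c D τ H| ≤ ε * τ.slope) (G : MRFG S n) :
    Continuous fun ω : Env S => controller c D τ (G.disjUnion (fbpTree ω)) := by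
  rw [continuous_iff_continuousAt]
  intro ω
  rw [ContinuousAt, Metric.tendsto_nhds]
  intro δ hδ
  have hε : 0 < δ / (τ.slope + 1) := by positivity
  refine (eventually_gameSim_fbpTrunc ω (2 ^ j) j hε le_rfl).mono fun ω' hω' => ?_
  have h1 := h _ hε.le _ _ (LocalSim.disjUnion_disjUnion G (isAcyclic_fbpTree ω)
    (isAcyclic_fbpTree ω') hω' (isEmb_ball _ _ _) (isEmb_ball _ _ _) rfl rfl
    (fullNear_ball _ _ _) (fullNear_ball _ _ _) s)
  rw [dist_comm, Real.dist_eq]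
  refine h1.trans_lt ?_
  rw [div_mul_eq_mul_div, div_lt_iff₀ (by positivity)]
  nlinarith

lemma integrable_of_continuous_controller (hS : IsCompact S) {τ : Term d (n + 1)} {G : MRFG S n}
    (h : Continuous fun ω : Env S => controller c D τ (G.disjUnion (fbpTree ω))) :
    Integrable (fun ω => controller c D τ (G.disjUnion (fbpTree ω))) (fbpMeasure c D) := by
  obtain ⟨M, -, hM⟩ := exists_abs_controller_le c D hS τ
  exact Integrable.of_bound h.measurable.aestronglyMeasurable M
    (Filter.Eventually.of_forall fun ω => hM _)

lemma abs_controller_sub_le_of_integrable (hS : IsCompact S) {ε : ℝ} (hε : 0 ≤ ε) (τ : Term d n)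
    (hint : ∀ m (π : Term d (m + 1)), Subterm (.mean π) τ → ∀ G : MRFG S m,
      Integrable (fun ω => controller c D π (G.disjUnion (fbpTree ω))) (fbpMeasure c D))
    {s j : ℕ} (hrank : τ.rank ≤ j) (hs : 2 ^ j ≤ 2 * s + 1) {G H : MRFG S n}
    (hsim : LocalSim ε 0 s j G H) :
    |controller c D τ G - controller c D τ H| ≤ ε * τ.slope := by
  refine abs_controller_sub_le c D hS hε le_rfl (fun _ _ => True) (fun _ _ _ _ => trivial)
    (fun _ _ _ _ _ => trivial) τ hint
    (fun m π _ ω => ⟨fbpTree ω, isAcyclic_fbpTree ω, fun _ _ => ⟨trivial, rfl⟩⟩) ?_ hrank hs trivial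
    trivial hsim
  intro m σ _
  obtain ⟨M, hM0, hM⟩ := exists_abs_controller_le c D hS σ
  exact ⟨M, hM0, by simpa using by positivity, fun G _ => hM G⟩

lemma continuous_controller_of_subterm (hS : IsCompact S) (τ : Term d n) {m : ℕ}
    {π : Term d (m + 1)} (h : Subterm (.mean π) τ) (G : MRFG S m) :
    Continuous fun ω : Env S => controller c D π (G.disjUnion (fbpTree ω)) := by
  induction τ generalizing m with
  | const a => cases h
  | val i j => cases h
  | edge i j => cases h
  | eq i j => cases h
  | app F hF args ih =>
    cases h with
    | app i h => exact ih i h G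
  | mean body ih =>
    cases h with
    | refl =>
      exact continuous_controller_fbpTree (s := 2 ^ body.rank) (j := body.rank) c D body
        (fun ε hε G H hsim => abs_controller_sub_le_of_integrable c D hS hε body
          (fun m σ h G => integrable_of_continuous_controller c D hS (ih h G))
          le_rfl (by omega) hsim) G
    | mean h => exact ih h G
  | lmean i body ih =>
    cases h with
    | lmean h => exact ih h G
  | sup body ih =>
    cases h with
    | sup h => exact ih h G

lemma continuous_controller (hS : IsCompact S) (π : Term d (n + 1)) (G : MRFG S n) :
    Continuous fun ω : Env S => controller c D π (G.disjUnion (fbpTree ω)) :=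
  continuous_controller_of_subterm c D hS (.mean π) .refl G

lemma integrable_controller (hS : IsCompact S) (π : Term d (n + 1)) (G : MRFG S n) :
    Integrable (fun ω => controller c D π (G.disjUnion (fbpTree ω))) (fbpMeasure c D) :=
  integrable_of_continuous_controller c D hS (continuous_controller c D hS π G)

/-- The controller sees only the first generations of an attached branching process. -/
lemma controller_disjUnion_fbpTrunc (hS : IsCompact S) (τ : Term d (n + 1)) (G : MRFG S n)
    (ω : Env S) {r : ℕ} (hr : 2 ^ τ.rank ≤ r) :
    controller c D τ (G.disjUnion (fbpTree ω)) =
      controller c D τ (G.disjUnion (fbpTrunc r ω)) := by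
  have hT : (fbpTrunc r ω).graph.IsAcyclic := isAcyclic_ball _ _ _ (isAcyclic_fbpTree ω)
  have h1 := LocalSim.disjUnion_disjUnion (ε := 0) (η := 0) G (isAcyclic_fbpTree ω) hT
    (GameSim.refl (k := τ.rank) (fbpTrunc r ω) le_rfl le_rfl) (isEmb_ball _ _ _)
    (isEmb_id _) rfl rfl ((fullNear_ball _ _ _).mono hr) (fullNear_id _ _ _) (2 ^ τ.rank)
  have h2 := abs_controller_sub_le_of_integrable c D hS le_rfl τ
    (fun m π _ G => integrable_controller c D hS π G) le_rfl (by omega) h1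
  rw [zero_mul] at h2
  exact sub_eq_zero.1 (abs_nonpos_iff.1 h2)

lemma isFiniteRootedTree_fbpTrunc (r : ℕ) (ω : Env S) : (fbpTrunc r ω).IsFiniteRootedTree :=
  isFiniteRootedTree_ball _ _ _ (isAcyclic_ball _ _ _ (isAcyclic_fbpTree ω))

lemma finite_disjUnion {m : ℕ} {G : MRFG S n} {T : MRFG S m} (hG : Finite G.V) (hT : Finite T.V) :
    Finite (G.disjUnion T).V :=
  inferInstanceAs (Finite (G.V ⊕ T.V))

/-- A bound for the controllers on finite graphs extends to attached branching processes. -/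
lemma abs_controller_disjUnion_fbpTree_le (hS : IsCompact S) {τ : Term d (n + 1)} {C : ℝ}
    (h : ∀ H : MRFG S (n + 1), Finite H.V → |controller c D τ H| ≤ C) {G : MRFG S n}
    (hG : Finite G.V) (ω : Env S) : |controller c D τ (G.disjUnion (fbpTree ω))| ≤ C := by
  rw [controller_disjUnion_fbpTrunc c D hS τ G ω le_rfl]
  exact h _ (finite_disjUnion hG (isFiniteRootedTree_fbpTrunc _ ω).1)

/-- Locally similar finite graphs have close controllers. -/
lemma abs_controller_sub_le_of_finite (hS : IsCompact S) {ε η C : ℝ} (hε : 0 ≤ ε) (hη : 0 ≤ η)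
    (hC : 0 ≤ C) (hCη : C * η ≤ ε / 4) {τ : Term d n}
    (hbound : ∀ {m : ℕ} (σ : Term d m), Subterm σ τ →
      ∀ H : MRFG S m, Finite H.V → |controller c D σ H| ≤ C)
    {s j : ℕ} (hrank : τ.rank ≤ j) (hs : 2 ^ j ≤ 2 * s + 1) {G H : MRFG S n}
    (hG : Finite G.V) (hH : Finite H.V) (hsim : LocalSim ε η s j G H) :
    |controller c D τ G - controller c D τ H| ≤ ε * τ.slope :=
  abs_controller_sub_le c D hS hε hη (fun _ G => Finite G.V) (fun _ _ _ h => h)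
    (fun _ _ _ hT h => finite_disjUnion h hT.1) τ
    (fun _ π _ G => integrable_controller c D hS π G)
    (fun _ π _ ω => ⟨_, (isFiniteRootedTree_fbpTrunc (2 ^ π.rank) ω).2.isAcyclic, fun G hG =>
      ⟨finite_disjUnion hG (isFiniteRootedTree_fbpTrunc _ ω).1,
        controller_disjUnion_fbpTrunc c D hS π G ω le_rfl⟩⟩)
    (fun _ σ h => ⟨C, hC, hCη, fun H hH => hbound σ h H hH⟩) hrank hs hG hH hsim

end Compare

/-! ### Counting vertices near roots and short cycles -/

section Counting

variable {n : ℕ} {G : MRFG S n}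

lemma card_nbrs_le_maxDeg (hG : Finite G.V) (v : G.V) : (G.nbrs v).card ≤ maxDeg G :=
  le_ciSup (f := fun v => (G.nbrs v).card) (Set.finite_range _).bddAbove v

lemma near_succ_iff {r : ℕ} {a b : G.V} :
    G.Near (r + 1) a b ↔ b = a ∨ ∃ c, G.Near r a c ∧ G.graph.Adj c b := by
  constructor
  · induction r with
    | zero =>
      intro h
      rcases near_one_iff.1 h with h | h
      · exact Or.inr ⟨a, by simp, h⟩
      · exact Or.inl h.symm
    | succ r ih =>
      intro h
      rcases h.succ_cases with h | h
      · rcases ih h with h | ⟨c, h, h'⟩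
        · exact Or.inl h
        · exact Or.inr ⟨c, h.mono (Nat.le_succ r), h'⟩
      · exact Or.inr h
  · rintro (rfl | ⟨c, h, h'⟩)
    · simp
    · exact h.trans (near_of_adj h' le_rfl)

lemma ncard_near_succ_le (hG : Finite G.V) (r : ℕ) (a : G.V) :
    {b | G.Near (r + 1) a b}.ncard ≤ 1 + {b | G.Near r a b}.ncard * maxDeg G := by
  classical
  have h1 : {b | G.Near (r + 1) a b} ⊆
      ((({a} : Finset G.V) ∪ (G.finite_near r a).toFinset.biUnion G.nbrs : Finset G.V) :
        Set G.V) := by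
    intro b hb
    rcases near_succ_iff.1 hb with rfl | ⟨c, h, h'⟩
    · simp
    · simp only [Finset.coe_union, Finset.coe_singleton, Set.mem_union]
      right
      simp only [Finset.coe_biUnion, Set.mem_iUnion]
      exact ⟨c, by simpa using h, by simpa using h'⟩
  refine (Set.ncard_le_ncard h1 (Finset.finite_toSet _)).trans ?_
  rw [Set.ncard_coe_finset]
  refine (Finset.card_union_le _ _).trans (add_le_add (by simp) ?_)
  refine (Finset.card_biUnion_le_card_mul _ _ _ fun c _ => card_nbrs_le_maxDeg hG c).trans ?_
  rw [Set.ncard_eq_toFinset_card _ (G.finite_near r a)]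

lemma ncard_near_lt (hG : Finite G.V) (hΔ : 2 ≤ maxDeg G) (r : ℕ) (a : G.V) :
    {b | G.Near r a b}.ncard + 1 ≤ maxDeg G ^ (r + 1) := by
  induction r with
  | zero =>
    have : {b | G.Near 0 a b} = {a} := by
      ext b
      simp [eq_comm]
    rw [this, Set.ncard_singleton, zero_add, pow_one]
    exact hΔ
  | succ r ih =>
    have h1 := ncard_near_succ_le hG r a
    have h2 := Nat.mul_le_mul_right (maxDeg G) ih
    rw [pow_succ _ (r + 1)]
    nlinarith

/-- The vertices near a root or near a short cycle. -/
def crowded (G : MRFG S n) (s j : ℕ) : Set G.V :=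
  {v | (∃ i, G.Near (2 ^ j) (G.roots i) v) ∨
    ∃ u, G.OnShortCycle (2 * s + 1) u ∧ G.Near (2 ^ j + s) v u}

lemma not_onShortCycle_one (v : G.V) : ¬ G.OnShortCycle 1 v := by
  rintro ⟨p, hp, hl⟩
  have := hp.three_le_length
  omega

lemma onShortCycle_mono {l l' : ℕ} (hl : l ≤ l') {v : G.V} (h : G.OnShortCycle l v) :
    G.OnShortCycle l' v := by
  obtain ⟨p, hp, h⟩ := h
  exact ⟨p, hp, h.trans hl⟩

lemma two_pow_add_one_le_three_pow {m : ℕ} (hm : 1 ≤ m) : 2 ^ m + 1 ≤ 3 ^ m := by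
  induction m, hm using Nat.le_induction with
  | base => norm_num
  | succ m _ ih =>
    rw [pow_succ, pow_succ]
    omega

lemma lt_radius {j K : ℕ} (hj : j + 1 ≤ K) (hK : 2 ≤ K) : 2 ^ j + 2 ^ j / 2 + 1 ≤ radius K := by
  obtain ⟨m, rfl⟩ := Nat.exists_eq_add_of_le' (show 1 ≤ K by omega)
  have h1 := two_pow_add_one_le_three_pow (m := m) (by omega)
  have h2 : 2 ^ j ≤ 2 ^ m := Nat.pow_le_pow_right (by norm_num) (by omega)
  have h3 : 3 ^ (m + 1) = 3 ^ m * 3 := pow_succ _ _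
  unfold radius
  rcases Nat.eq_zero_or_pos j with rfl | hj0
  · norm_num at *
    have : 3 ≤ 3 ^ m := by
      calc 3 = 3 ^ 1 := by norm_num
        _ ≤ 3 ^ m := Nat.pow_le_pow_right (by norm_num) (by omega)
    omega
  · obtain ⟨i, rfl⟩ := Nat.exists_eq_add_of_le' hj0
    rw [pow_succ] at *
    omega

lemma two_pow_le_radius {j k : ℕ} (hj : j + 1 ≤ k) : 2 ^ j ≤ radius k := by
  have h1 : 2 ^ j ≤ 3 ^ j := Nat.pow_le_pow_left (by norm_num) j
  have h2 : 3 ^ (j + 1) ≤ 3 ^ k := Nat.pow_le_pow_right (by norm_num) hj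
  rw [pow_succ] at h2
  have h3 : 1 ≤ 2 ^ j := Nat.one_le_two_pow
  unfold radius
  omega

lemma ncard_crowded_le (hG : Finite G.V) (hΔ : 2 ≤ maxDeg G) {s j r : ℕ}
    (hr : 2 ^ j + s + 1 ≤ r) : (crowded G s j).ncard ≤ (n + cycleCount r G) * maxDeg G ^ r := by
  classical
  obtain ⟨r, rfl⟩ := Nat.exists_eq_add_of_le' (le_of_add_le_right hr)
  have hpos : 0 < 2 ^ j := by positivity
  let Z : Finset G.V := (Finset.univ.image G.roots) ∪
    (Set.toFinite {v | G.OnShortCycle (2 * (r + 1) + 1) v}).toFinset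
  have hZ : Z.card ≤ n + cycleCount (r + 1) G := by
    refine (Finset.card_union_le _ _).trans (add_le_add ?_ ?_)
    · exact Finset.card_image_le.trans (by simp)
    · rw [cycleCount, Set.ncard_eq_toFinset_card]
  have h1 : crowded G s j ⊆ ((Z.biUnion fun z => (G.finite_near r z).toFinset : Finset G.V) :
      Set G.V) := by
    intro v hv
    simp only [Finset.coe_biUnion, Set.mem_iUnion]
    rcases hv with ⟨i, h⟩ | ⟨u, hu, h⟩
    · exact ⟨G.roots i, by simp [Z], by simpa using h.mono (by omega)⟩
    · refine ⟨u, ?_, by simpa using h.symm.mono (by omega)⟩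
      simp only [Z, Finset.coe_union, Set.mem_union]
      right
      simpa using onShortCycle_mono (by omega) hu
  refine (Set.ncard_le_ncard h1 (Finset.finite_toSet _)).trans ?_
  rw [Set.ncard_coe_finset]
  refine (Finset.card_biUnion_le_card_mul _ _ (maxDeg G ^ (r + 1)) fun z _ => ?_).trans
    (Nat.mul_le_mul_right _ hZ)
  have := ncard_near_lt hG hΔ r z
  rw [Set.ncard_eq_toFinset_card _ (G.finite_near r z)] at this
  omega

lemma ncard_crowded_zero_le (hG : Finite G.V) (hΔ : maxDeg G = 1) :
    (crowded G 0 0).ncard ≤ n * 2 := by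
  classical
  have h1 : crowded G 0 0 ⊆ (((Finset.univ.image G.roots).biUnion
      fun z => (G.finite_near 1 z).toFinset : Finset G.V) : Set G.V) := by
    intro v hv
    simp only [Finset.coe_biUnion, Set.mem_iUnion]
    rcases hv with ⟨i, h⟩ | ⟨u, hu, h⟩
    · exact ⟨G.roots i, by simp, by simpa using h⟩
    · exact (not_onShortCycle_one u hu).elim
  refine (Set.ncard_le_ncard h1 (Finset.finite_toSet _)).trans ?_
  rw [Set.ncard_coe_finset]
  refine (Finset.card_biUnion_le_card_mul _ _ 2 fun z _ => ?_).trans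
    (Nat.mul_le_mul_right _ (Finset.card_image_le.trans (by simp)))
  have := ncard_near_succ_le hG 0 z
  rw [hΔ, Set.ncard_eq_toFinset_card _ (G.finite_near _ z)] at this
  have h0 : {b | G.Near 0 z b} = {z} := by
    ext b
    simp [eq_comm]
  rw [h0, Set.ncard_singleton] at this
  simpa using this

lemma crowded_fraction_le (hG : Finite G.V) (hΔ : 2 ≤ maxDeg G) {K j : ℕ} {η : ℝ} (hη : 0 ≤ η)
    (hn : n + j + 1 ≤ K) (hhom : IsHomogeneous K η (radius K) G) :
    ((crowded G (2 ^ j / 2) j).ncard : ℝ) / Nat.card G.V ≤ η := by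
  rcases Nat.lt_or_ge K 2 with hK | hK
  · obtain rfl : j = 0 := by omega
    obtain rfl : n = 0 := by omega
    have : crowded G (2 ^ 0 / 2) 0 = ∅ := by
      rw [Set.eq_empty_iff_forall_notMem]
      rintro v (⟨i, -⟩ | ⟨u, hu, -⟩)
      · exact i.elim0
      · exact not_onShortCycle_one u hu
    rw [this]
    simpa using hη
  · refine le_trans ?_ hhom
    gcongr
    refine (ncard_crowded_le hG hΔ (lt_radius (by omega) hK)).trans ?_
    gcongr
    omega

lemma crowded_zero_fraction_le (hG : Finite G.V) (hΔ : maxDeg G = 1) {K : ℕ} {η : ℝ}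
    (hn : n + 1 ≤ K) (hhom : IsHomogeneous K η (radius K) G) :
    ((crowded G 0 0).ncard : ℝ) / Nat.card G.V ≤ 2 * η := by
  have h1 : ((crowded G 0 0).ncard : ℝ) ≤ (((K + cycleCount (radius K) G) *
      maxDeg G ^ radius K : ℕ) : ℝ) * 2 := by
    rw [hΔ, one_pow, mul_one]
    have := ncard_crowded_zero_le hG hΔ
    exact_mod_cast this.trans (Nat.mul_le_mul_right 2 (by omega))
  calc ((crowded G 0 0).ncard : ℝ) / Nat.card G.V
      ≤ (((K + cycleCount (radius K) G) * maxDeg G ^ radius K : ℕ) : ℝ) * 2 / Nat.card G.V := by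
        gcongr
    _ = 2 * ((((K + cycleCount (radius K) G) * maxDeg G ^ radius K : ℕ) : ℝ) / Nat.card G.V) := by
        ring
    _ ≤ 2 * η := by
        have : _ ≤ η := hhom
        linarith

end Counting

/-! ### Richness -/

section Rich

variable {n k J R : ℕ} {ε η : ℝ}

/-- Every finite tree has `J` similar balls in `G`, far from one another, from the roots and from
the short cycles. -/
def RichAt (k : ℕ) (ε η : ℝ) (R J : ℕ) (G : MRFG S n) : Prop :=
  ∀ T : MRFG S 1, T.IsFiniteRootedTree → ∃ v : Fin J → G.V,
    (∀ i, GameSim ε η k (G.ball R (v i)) (T.ball R (T.roots 0))) ∧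
    (∀ i i', i ≠ i' → ¬ G.Near (2 * R + 1) (v i) (v i')) ∧
    (∀ i i', ¬ G.Near R (G.roots i') (v i)) ∧
    (∀ i u, G.OnShortCycle (2 * R + 1) u → ¬ G.Near (2 * R + 1) (v i) u)

lemma IsRich.richAt {G : MRFG S n} (h : IsRich k ε η R G) : RichAt k ε η R k G := by
  intro T hT
  obtain ⟨v, h1, h2, h3⟩ := h R le_rfl (T.ball R (T.roots 0))
    (isFiniteRootedTree_ball _ _ _ (isAcyclic_ball _ _ _ hT.2.isAcyclic)) (heightLE_ball _ _ _)
  refine ⟨v, h1, fun i i' hne => not_le_of_gt (h2 i i' hne), fun i i' hn => ?_,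
    fun i u hu => not_le_of_gt ((h3 i).2 u hu)⟩
  exact not_le_of_gt ((h3 i).1 i') (hn.symm.mono (by omega))

lemma RichAt.addRoot {G : MRFG S n} (h : RichAt k ε η R (J + 1) G) (w : G.V) :
    RichAt k ε η R J (G.addRoot w) := by
  intro T hT
  obtain ⟨v, h1, h2, h3, h4⟩ := h T hT
  have hex : ∃ i₀, ∀ i, i ≠ i₀ → ¬ G.Near R w (v i) := by
    by_cases hw : ∃ i₀, G.Near R w (v i₀)
    · obtain ⟨i₀, hi₀⟩ := hw
      exact ⟨i₀, fun i hi hn => h2 i i₀ hi ((hn.symm.trans hi₀).mono (by omega))⟩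
    · push Not at hw
      exact ⟨0, fun i _ => hw i⟩
  obtain ⟨i₀, hi₀⟩ := hex
  refine ⟨fun i => v (i₀.succAbove i), fun i => h1 _,
    fun i i' hne => h2 _ _ (fun h => hne (Fin.succAbove_right_injective h)), fun i i' => ?_,
    fun i => h4 _⟩
  refine Fin.lastCases ?_ (fun i' => ?_) i'
  · rw [addRoot_roots_last]
    exact hi₀ _ (Fin.succAbove_ne i₀ i)
  · rw [addRoot_roots_castSucc]
    exact h3 _ _

/-- The star with two leaves, of features `x` and `y`. -/
def twoStar (x y : S) : MRFG S 1 where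
  V := Fin 3
  graph := SimpleGraph.starGraph 0
  locFin := fun _ => Set.toFinite _
  feat := ![x, x, y]
  roots := fun _ => (0 : Fin 3)

lemma isFiniteRootedTree_twoStar (x y : S) : (twoStar x y).IsFiniteRootedTree :=
  ⟨inferInstanceAs (Finite (Fin 3)), SimpleGraph.isTree_starGraph _⟩

lemma twoStar_adj (x y : S) {i : Fin 3} (hi : i ≠ 0) :
    (twoStar x y).graph.Adj ((twoStar x y).roots 0) i :=
  SimpleGraph.starGraph_center_adj hi.symm

lemma exists_leaves_twoStar (x y : S) : ∃ a b : (twoStar x y).V, a ≠ b ∧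
    (twoStar x y).graph.Adj ((twoStar x y).roots 0) a ∧
    (twoStar x y).graph.Adj ((twoStar x y).roots 0) b ∧
    (twoStar x y).feat a = x ∧ (twoStar x y).feat b = y :=
  ⟨(1 : Fin 3), (2 : Fin 3), (by decide : (1 : Fin 3) ≠ 2), twoStar_adj x y (by decide), twoStar_adj x y (by decide),
    rfl, rfl⟩

lemma heightLE_twoStar (x y : S) {r : ℕ} (hr : 1 ≤ r) : (twoStar x y).HeightLE r := by
  intro i
  by_cases hi : i = (0 : Fin 3)
  · subst hi
    exact near_self _ _ _
  · exact near_of_adj (twoStar_adj x y hi) hr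

lemma GameSim.adj_last_of_addRoot {P Q : MRFG S (n + 1)} {p : P.V} {q : Q.V} {l : ℕ}
    (h : GameSim ε η l (P.addRoot p) (Q.addRoot q)) (i : Fin (n + 1)) :
    (Q.graph.Adj (Q.roots i) q → P.graph.Adj (P.roots i) p) ∧ (Q.roots i ≠ q → P.roots i ≠ p) ∧
      ‖(P.feat p).1 - (Q.feat q).1‖ ≤ ε := by
  have : Nonempty (P.addRoot p).V := ⟨p⟩
  have h0 := h.mono (Nat.zero_le l)
  have h1 := h0.1 i.castSucc (Fin.last _)
  have h2 := h0.2.1 i.castSucc (Fin.last _)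
  have h3 := h0.2.2 (Fin.last _)
  rw [addRoot_roots_castSucc, addRoot_roots_castSucc, addRoot_roots_last, addRoot_roots_last]
    at h1 h2
  rw [addRoot_roots_last, addRoot_roots_last] at h3
  exact ⟨h2.2, mt h1.1, h3⟩

/-- Rich graphs have vertices of degree at least two, unless `k = 1` and all features are close. -/
lemma IsRich.two_le_maxDeg_or {G : MRFG S n} (hG : Finite G.V) [Nonempty S] (hk : 1 ≤ k)
    (hR : 1 ≤ R) (h : IsRich k ε η R G) :
    2 ≤ maxDeg G ∨ (maxDeg G = 1 ∧ k = 1 ∧ ∀ x y : S, ‖x.1 - y.1‖ ≤ 2 * ε) := by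
  have hrep : ∀ x y : S, ∃ v : G.V, GameSim ε η k (G.ball R v) (twoStar x y) := fun x y => by
    obtain ⟨v, hv, -⟩ := h R le_rfl (twoStar x y) (isFiniteRootedTree_twoStar x y)
      (heightLE_twoStar x y hR)
    exact ⟨v ⟨0, hk⟩, hv _⟩
  obtain ⟨k, rfl⟩ := Nat.exists_eq_add_of_le' hk
  have hleaf : ∀ x y : S, ∃ v p q : G.V, G.graph.Adj v p ∧ G.graph.Adj v q ∧
      ‖(G.feat p).1 - x.1‖ ≤ ε ∧ ‖(G.feat q).1 - y.1‖ ≤ ε := by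
    intro x y
    obtain ⟨v, hv⟩ := hrep x y
    obtain ⟨a, b, -, ha, hb, hax, hby⟩ := exists_leaves_twoStar x y
    obtain ⟨p, hp⟩ := (gameSim_succ.1 hv).2.1 a
    obtain ⟨q, hq⟩ := (gameSim_succ.1 hv).2.1 b
    have h1 := hp.adj_last_of_addRoot 0
    have h2 := hq.adj_last_of_addRoot 0
    rw [hax] at h1
    rw [hby] at h2
    exact ⟨v, p.1, q.1, h1.1 ha, h2.1 hb, h1.2.2, h2.2.2⟩
  have htwo : ∀ v p q : G.V, G.graph.Adj v p → G.graph.Adj v q → p ≠ q → 2 ≤ maxDeg G := by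
    intro v p q hp hq hpq
    refine le_trans ?_ (card_nbrs_le_maxDeg hG v)
    exact Finset.one_lt_card.2 ⟨p, by simpa using hp, q, by simpa using hq, hpq⟩
  by_cases hΔ : 2 ≤ maxDeg G
  · exact Or.inl hΔ
  right
  refine ⟨?_, ?_, ?_⟩
  · obtain ⟨x⟩ := ‹Nonempty S›
    obtain ⟨v, p, q, hp, -⟩ := hleaf x x
    have h1 := card_nbrs_le_maxDeg hG v
    have h2 : 0 < (G.nbrs v).card := Finset.card_pos.2 ⟨p, by simpa using hp⟩
    omega
  · by_contra hk
    obtain ⟨l, rfl⟩ := Nat.exists_eq_add_of_le' (show 1 ≤ k by omega)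
    obtain ⟨x⟩ := ‹Nonempty S›
    obtain ⟨v, hv⟩ := hrep x x
    obtain ⟨a, b, hab, ha, hb, -⟩ := exists_leaves_twoStar x x
    obtain ⟨p, hp⟩ := (gameSim_succ.1 hv).2.1 a
    obtain ⟨q, hq⟩ := (gameSim_succ.1 hp).2.1 b
    have h1 := hp.adj_last_of_addRoot 0
    have h2 := hq.adj_last_of_addRoot (Fin.castSucc 0)
    have h3 := hq.adj_last_of_addRoot (Fin.last 1)
    rw [addRoot_roots_castSucc, addRoot_roots_castSucc] at h2
    rw [addRoot_roots_last, addRoot_roots_last] at h3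
    refine hΔ (htwo v p.1 q.1 (h1.1 ha) (h2.1 hb) ?_)
    exact fun hpq => h3.2.1 hab (Subtype.ext hpq)
  · intro x y
    obtain ⟨v, p, q, hp, hq, hx, hy⟩ := hleaf x y
    have hpq : p = q := by
      by_contra hpq
      exact hΔ (htwo v p q hp hq hpq)
    subst hpq
    have h1 := norm_sub_le_norm_sub_add_norm_sub x.1 (G.feat p).1 y.1
    rw [norm_sub_rev] at hx
    linarith

end Rich

/-! ### Averages and expectations under a coupling -/

lemma abs_average_sub_integral_le {V E : Type*} [Finite V] [MeasurableSpace V]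
    [MeasurableSingletonClass V] [MeasurableSpace E] {P : Measure (V × E)} {μ : Measure E}
    [IsProbabilityMeasure μ] (hfst : P.map Prod.fst = uniformOn Set.univ)
    (hsnd : P.map Prod.snd = μ) {a : V → ℝ} {b : E → ℝ} (hb : Measurable b) {M : ℝ}
    (hM : ∀ ω, |b ω| ≤ M) {A : Set (V × E)} {B : Set V} {α β γ η : ℝ} (hγ : 0 ≤ γ)
    (hA : 1 - η ≤ P.real A) (h1 : ∀ x ∈ A, x.1 ∉ B → |a x.1 - b x.2| ≤ α)
    (h2 : ∀ v ∈ B, ∀ ω, |a v - b ω| ≤ α + β) (h3 : ∀ v ∉ B, ∀ ω, |a v - b ω| ≤ α + γ) :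
    |(∑ᶠ v, a v) / Nat.card V - ∫ ω, b ω ∂μ| ≤
      α + β * ((B.ncard : ℝ) / Nat.card V) + γ * η := by
  classical
  have := Fintype.ofFinite V
  have hP : IsProbabilityMeasure P := by
    constructor
    rw [← Set.preimage_univ (f := Prod.snd), ← Measure.map_apply measurable_snd .univ, hsnd]
    simp
  have ha : Measurable a := measurable_of_finite a
  obtain ⟨Ma, hMa⟩ := (Set.finite_range fun v => |a v|).bddAbove
  have hinta : Integrable (fun x : V × E => a x.1) P :=
    Integrable.of_bound (ha.comp measurable_fst).aestronglyMeasurable Ma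
      (Filter.Eventually.of_forall fun x => hMa ⟨x.1, rfl⟩)
  have hintb : Integrable (fun x : V × E => b x.2) P :=
    Integrable.of_bound (hb.comp measurable_snd).aestronglyMeasurable M
      (Filter.Eventually.of_forall fun x => hM x.2)
  have hunif : ∀ B : Set V, P.real (Prod.fst ⁻¹' B) = (B.ncard : ℝ) / Nat.card V := by
    intro B
    have hB : MeasurableSet B := B.toFinite.measurableSet
    rw [← map_measureReal_apply measurable_fst hB, hfst, measureReal_def, uniformOn_univ,
      ENNReal.toReal_div, Measure.count_apply_finite B B.toFinite,
      Set.ncard_eq_toFinset_card B B.toFinite]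
    simp
  have hsuma : (∑ᶠ v, a v) / Nat.card V = ∫ x, a x.1 ∂P := by
    rw [← integral_map (φ := Prod.fst) (f := a) measurable_fst.aemeasurable
      ha.aestronglyMeasurable, integral_fintype (Integrable.of_finite),
      finsum_eq_sum_of_fintype, Finset.sum_div]
    refine Finset.sum_congr rfl fun v _ => ?_
    rw [map_measureReal_apply measurable_fst (measurableSet_singleton v), hunif]
    simp
    ring
  have hsumb : ∫ ω, b ω ∂μ = ∫ x, b x.2 ∂P := by
    rw [← hsnd, integral_map measurable_snd.aemeasurable hb.aestronglyMeasurable]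
  have hBm : MeasurableSet (Prod.fst ⁻¹' B : Set (V × E)) :=
    measurable_fst B.toFinite.measurableSet
  let N : Set (V × E) := {x | x.1 ∉ B ∧ α < |a x.1 - b x.2|}
  have hNm : MeasurableSet N := by
    refine hBm.compl.inter ?_
    exact measurableSet_lt measurable_const
      (((ha.comp measurable_fst).sub (hb.comp measurable_snd)).abs)
  have hN : P.real N ≤ η := by
    have h4 : A ⊆ Nᶜ := fun x hx hN => not_le_of_gt hN.2 (h1 x hx hN.1)
    have h5 := measureReal_mono h4 (measure_ne_top P _)
    rw [probReal_compl_eq_one_sub hNm] at h5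
    linarith
  have hint : ∀ {B : Set (V × E)} {β : ℝ}, MeasurableSet B →
      Integrable (B.indicator fun _ => β) P := fun hB => (integrable_const _).indicator hB
  rw [hsuma, hsumb, ← integral_sub hinta hintb]
  calc |∫ x, a x.1 - b x.2 ∂P| ≤ ∫ x, |a x.1 - b x.2| ∂P := abs_integral_le_integral_abs
    _ ≤ ∫ x, α + (Prod.fst ⁻¹' B).indicator (fun _ => β) x + N.indicator (fun _ => γ) x ∂P := by
        refine integral_mono (hinta.sub hintb).abs
          (((integrable_const α).add (hint hBm)).add (hint hNm)) fun x => ?_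
        dsimp only
        by_cases hx : x.1 ∈ B
        · have hx' : x ∈ (Prod.fst ⁻¹' B : Set (V × E)) := hx
          have hxN : x ∉ N := fun h => h.1 hx
          rw [Set.indicator_of_mem hx', Set.indicator_of_notMem hxN, add_zero]
          exact h2 x.1 hx x.2
        · have hx' : x ∉ (Prod.fst ⁻¹' B : Set (V × E)) := hx
          rw [Set.indicator_of_notMem hx', add_zero]
          by_cases hxN : x ∈ N
          · rw [Set.indicator_of_mem hxN]
            exact h3 x.1 hx x.2
          · rw [Set.indicator_of_notMem hxN, add_zero]
            by_contra hlt
            exact hxN ⟨hx, not_le.1 hlt⟩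
    _ = α + P.real (Prod.fst ⁻¹' B) * β + P.real N * γ := by
        rw [integral_add (f := fun x => α + (Prod.fst ⁻¹' B).indicator (fun _ => β) x)
            (g := fun x => N.indicator (fun _ => γ) x)
            ((integrable_const α).add (hint hBm)) (hint hNm),
          integral_add (f := fun _ => α) (g := fun x => (Prod.fst ⁻¹' B).indicator (fun _ => β) x)
            (integrable_const α) (hint hBm), integral_indicator_const _ hBm,
          integral_indicator_const _ hNm]
        simp
    _ ≤ α + β * ((B.ncard : ℝ) / Nat.card V) + γ * η := by
        rw [hunif]
        nlinarith

/-! ### The main induction -/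

lemma abs_finsum_average_sub_le {V : Type*} [Finite V] {a b : V → ℝ} {δ : ℝ} (hδ : 0 ≤ δ)
    (h : ∀ v, |a v - b v| ≤ δ) :
    |(∑ᶠ v, a v) / Nat.card V - (∑ᶠ v, b v) / Nat.card V| ≤ δ := by
  have := Fintype.ofFinite V
  rw [finsum_eq_sum_of_fintype, finsum_eq_sum_of_fintype, ← sub_div, ← Finset.sum_sub_distrib,
    Nat.card_eq_fintype_card, Fintype.card]
  exact abs_average_le hδ fun v _ => h v

section Main

variable {n : ℕ} (c : ℝ≥0) (D : Measure S) [IsProbabilityMeasure D]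

lemma abs_controller_addRoot_sub_le (hS : IsCompact S) {ε η C : ℝ} (hε : 0 ≤ ε) (hη : 0 ≤ η)
    (hC : 0 ≤ C) (hCη : C * η ≤ ε / 4) {π : Term d (n + 1)}
    (hbound : ∀ {m : ℕ} (σ : Term d m), Subterm σ π →
      ∀ H : MRFG S m, Finite H.V → |controller c D σ H| ≤ C)
    {j R : ℕ} (hrank : π.rank ≤ j) (hR : 2 ^ j ≤ R) {G : MRFG S n} (hG : Finite G.V) {v : G.V}
    (hv : v ∉ crowded G (2 ^ j / 2) j) {ω : Env S}
    (hsim : GameSim ε η j (G.ball R v) (fbpTrunc R ω)) :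
    |controller c D π (G.addRoot v) - controller c D π (G.disjUnion (fbpTree ω))| ≤
      ε * π.slope := by
  have hT := isFiniteRootedTree_fbpTrunc R ω
  rw [controller_disjUnion_fbpTrunc c D hS π G ω
    ((Nat.pow_le_pow_right (by norm_num) hrank).trans hR)]
  refine abs_controller_sub_le_of_finite c D hS hε hη hC hCη hbound hrank (s := 2 ^ j / 2)
    (by omega) hG (finite_disjUnion hG hT.1) ?_
  simp only [crowded, Set.mem_ofPred_eq, not_or, not_exists, not_and] at hv
  exact LocalSim.addRoot_disjUnion hR hT.2.isAcyclic hsim (isEmb_id _) rfl (fullNear_id _ _ _)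
    hv.1 hv.2

lemma abs_average_controller_sub_integral_le (hS : IsCompact S) {ε η C : ℝ} (hε : 0 ≤ ε)
    (hη : 0 ≤ η) (hC : 0 ≤ C) (hCη : 4 * (C * η) = ε) {π : Term d (n + 1)}
    (hbound : ∀ {m : ℕ} (σ : Term d m), Subterm σ π →
      ∀ H : MRFG S m, Finite H.V → |controller c D σ H| ≤ C)
    {j k K : ℕ} (hrank : π.rank ≤ j) (hj : j + 1 ≤ k) (hn : n + j + 1 ≤ K) {G : MRFG S n}
    (hG : Finite G.V) (hclose : IsCloseToFBP c D k ε η (radius k) G)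
    (hhom : IsHomogeneous K η (radius K) G)
    (hdeg : 2 ≤ maxDeg G ∨ (maxDeg G = 1 ∧ k = 1 ∧ ∀ x y : S, ‖x.1 - y.1‖ ≤ 2 * ε)) :
    |(∑ᶠ v, controller c D π (G.addRoot v)) / Nat.card G.V -
      ∫ ω, controller c D π (G.disjUnion (fbpTree ω)) ∂(fbpMeasure c D)| ≤
        ε * (π.slope + 1) := by
  let _ : MeasurableSpace G.V := ⊤
  have : MeasurableSingletonClass G.V := ⟨fun _ => trivial⟩
  obtain ⟨P, hfst, hsnd, hP⟩ := hclose
  have hmeas := (continuous_controller c D hS π G).measurable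
  have hb1 : ∀ v, |controller c D π (G.addRoot v)| ≤ C := fun v => hbound π .refl _ hG
  have hb2 : ∀ ω, |controller c D π (G.disjUnion (fbpTree ω))| ≤ C := fun ω =>
    abs_controller_disjUnion_fbpTree_le c D hS (hbound π .refl) hG ω
  have hb : ∀ v ω, |controller c D π (G.addRoot v) -
      controller c D π (G.disjUnion (fbpTree ω))| ≤ 2 * C := fun v ω => by
    linarith [abs_sub (controller c D π (G.addRoot v))
      (controller c D π (G.disjUnion (fbpTree ω))), hb1 v, hb2 ω]
  have hs : 0 ≤ ε * π.slope := by positivity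
  have hgood : ∀ x ∈ {x : G.V × Env S | GameSim ε η k (G.ball (radius k) x.1)
      (fbpTrunc (radius k) x.2)}, x.1 ∉ crowded G (2 ^ j / 2) j →
      |controller c D π (G.addRoot x.1) - controller c D π (G.disjUnion (fbpTree x.2))| ≤
        ε * π.slope := by
    intro x hx hxB
    have : Nonempty (G.ball (radius k) x.1).V := ⟨(G.ball (radius k) x.1).roots 0⟩
    exact abs_controller_addRoot_sub_le c D hS hε hη hC (by linarith) hbound hrank
      (two_pow_le_radius hj) hG hxB (GameSim.mono hx (by omega))
  rcases hdeg with hdeg | ⟨hdeg, hk1, hdiam⟩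
  · have h1 := abs_average_sub_integral_le hfst hsnd hmeas hb2 (β := 2 * C) (γ := 2 * C)
      (by positivity) hP hgood (fun v _ ω => (hb v ω).trans (by linarith))
      (fun v _ ω => (hb v ω).trans (by linarith))
    have h2 := crowded_fraction_le hG hdeg hη hn hhom
    refine h1.trans ?_
    nlinarith
  obtain rfl : j = 0 := by omega
  have hfrac : ((crowded G (2 ^ 0 / 2) 0).ncard : ℝ) / Nat.card G.V ≤ 2 * η :=
    crowded_zero_fraction_le hG hdeg (by omega) hhom
  rcases le_total (2 * C) (ε * π.slope) with hCs | hCs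
  · have h1 := abs_average_sub_integral_le hfst hsnd hmeas hb2 (β := 0) (γ := 0) le_rfl hP hgood
      (fun v _ ω => (hb v ω).trans (by linarith)) (fun v _ ω => (hb v ω).trans (by linarith))
    refine h1.trans ?_
    nlinarith
  · have h1 := abs_average_sub_integral_le hfst hsnd hmeas hb2 (β := 2 * C - ε * π.slope)
      (γ := ε * π.slope) hs hP hgood (fun v _ ω => (hb v ω).trans (by linarith)) (fun v hv ω => by
        refine (abs_controller_addRoot_sub_le c D hS (ε := 2 * ε) (by positivity) hη hC
          (by linarith) hbound hrank (two_pow_le_radius hj) hG hv (ω := ω) ?_).trans (by linarith)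
        exact ⟨fun i i' => by simp [Subsingleton.elim i i'],
          fun i i' => by simp [Subsingleton.elim i i'], fun i => hdiam _ _⟩)
    refine h1.trans ?_
    have h2 := mul_le_mul_of_nonneg_left hfrac (sub_nonneg.2 hCs)
    nlinarith [mul_nonneg hs hη]

lemma exists_abs_controller_addRoot_sub_le (hS : IsCompact S) {ε η C : ℝ} (hε : 0 ≤ ε)
    (hη : 0 ≤ η) (hC : 0 ≤ C) (hCη : C * η ≤ ε / 4) {π : Term d (n + 1)}
    (hbound : ∀ {m : ℕ} (σ : Term d m), Subterm σ π →
      ∀ H : MRFG S m, Finite H.V → |controller c D σ H| ≤ C)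
    {j k R J : ℕ} (hrank : π.rank ≤ j) (hj : j ≤ k) (hR : 2 ^ j ≤ R) {G : MRFG S n}
    (hG : Finite G.V) (hrich : RichAt k ε η R (J + 1) G) {T : MRFG S 1}
    (hT : T.IsFiniteRootedTree) :
    ∃ v, |controller c D π (G.disjUnion T) - controller c D π (G.addRoot v)| ≤ ε * π.slope := by
  obtain ⟨v, h1, -, h3, h4⟩ := hrich T hT
  refine ⟨v 0, ?_⟩
  rw [abs_sub_comm]
  have : Nonempty (G.ball R (v 0)).V := ⟨(G.ball R (v 0)).roots 0⟩
  refine abs_controller_sub_le_of_finite c D hS hε hη hC hCη hbound hrank (s := 2 ^ j / 2)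
    (by omega) hG (finite_disjUnion hG hT.1) ?_
  refine LocalSim.addRoot_disjUnion hR hT.2.isAcyclic ((h1 0).mono hj) (isEmb_ball _ _ _) rfl
    ((fullNear_ball _ _ _).mono hR) (fun i hn => h3 0 i (hn.mono hR)) fun u hu hn => ?_
  exact h4 0 u (onShortCycle_mono (by omega) hu) (hn.mono (by omega))

theorem abs_eval_sub_controller_le (hS : IsCompact S) {ε η C : ℝ} (hε : 0 ≤ ε)
    (hη : 0 ≤ η) (hC : 0 ≤ C) (hCη : 4 * (C * η) = ε) {k K : ℕ} (τ : Term d n)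
    (hbound : ∀ {m : ℕ} (σ : Term d m), Subterm σ τ →
      ∀ H : MRFG S m, Finite H.V → |controller c D σ H| ≤ C)
    {j : ℕ} (hrank : τ.rank ≤ j) (hj : j ≤ k) (hn : n + j ≤ K) (G : MRFG S n)
    (hG : Finite G.V) (hne : Nonempty G.V) (hrich : RichAt k ε η (radius k) j G)
    (hclose : IsCloseToFBP c D k ε η (radius k) G)
    (hhom : IsHomogeneous K η (radius K) G)
    (hdeg : 1 ≤ k → 2 ≤ maxDeg G ∨
      (maxDeg G = 1 ∧ k = 1 ∧ ∀ x y : S, ‖x.1 - y.1‖ ≤ 2 * ε)) :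
    |eval τ G - controller c D τ G| ≤ ε * τ.slope * j := by
  induction τ generalizing j with
  | const a =>
    rw [eval, controller, sub_self, abs_zero]
    positivity
  | val i l =>
    rw [eval, controller, sub_self, abs_zero]
    positivity
  | edge i l =>
    rw [eval, controller, sub_self, abs_zero]
    positivity
  | eq i l =>
    rw [eval, controller, sub_self, abs_zero]
    positivity
  | app F hF args ih =>
    rw [eval, controller, Term.slope, mul_right_comm]
    refine abs_app_sub_le hF (by positivity) fun i => ?_
    rw [Term.rank, Finset.sup_le_iff] at hrank
    rw [mul_right_comm]
    exact ih i (fun σ h => hbound σ (.app i h)) (hrank i (Finset.mem_univ i)) hj hn G hG hne hrich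
      hclose hhom hdeg
  | mean body ih =>
    obtain ⟨j, rfl⟩ := Nat.exists_eq_add_of_le' (show 1 ≤ j by simp only [Term.rank] at hrank; omega)
    rw [Term.rank, Nat.add_le_add_iff_right] at hrank
    have hb : ∀ {m : ℕ} (σ : Term d m), Subterm σ body →
      ∀ H : MRFG S m, Finite H.V → |controller c D σ H| ≤ C := fun σ h => hbound σ (.mean h)
    have h1 : |(∑ᶠ v : G.V, eval body (G.addRoot v)) / Nat.card G.V -
        (∑ᶠ v : G.V, controller c D body (G.addRoot v)) / Nat.card G.V| ≤ ε * body.slope * j :=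
      abs_finsum_average_sub_le (by positivity) fun v =>
        ih hb hrank (by omega) (by omega) (G.addRoot v) hG hne (hrich.addRoot v) hclose hhom hdeg
    have h2 := abs_average_controller_sub_integral_le c D hS hε hη hC hCη hb hrank hj (by omega)
      hG hclose hhom (hdeg (by omega))
    rw [eval, controller]
    refine (abs_sub_le _ _ _).trans ((add_le_add h1 h2).trans ?_)
    simp only [Term.slope, NNReal.coe_add, NNReal.coe_one, Nat.cast_add, Nat.cast_one]
    have : (0 : ℝ) ≤ ε * j := by positivity
    nlinarith
  | lmean i body ih =>
    obtain ⟨j, rfl⟩ := Nat.exists_eq_add_of_le' (show 1 ≤ j by simp only [Term.rank] at hrank; omega)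
    rw [Term.rank, Nat.add_le_add_iff_right] at hrank
    rw [eval, controller]
    by_cases h0 : G.nbrs (G.roots i) = ∅
    · rw [if_pos h0, if_pos h0, sub_self, abs_zero]
      positivity
    · rw [if_neg h0, if_neg h0, ← sub_div, ← Finset.sum_sub_distrib]
      refine (abs_average_le (C := ε * body.slope * j) (by positivity) fun v _ => ?_).trans ?_
      · exact ih (fun σ h => hbound σ (.lmean h)) hrank (by omega) (by omega) (G.addRoot v) hG hne
          (hrich.addRoot v) hclose hhom hdeg
      · simp only [Term.slope, NNReal.coe_add, NNReal.coe_one, Nat.cast_add, Nat.cast_one]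
        gcongr <;> linarith
  | sup body ih =>
    obtain ⟨j, rfl⟩ := Nat.exists_eq_add_of_le' (show 1 ≤ j by simp only [Term.rank] at hrank; omega)
    rw [Term.rank, Nat.add_le_add_iff_right] at hrank
    have hb : ∀ {m : ℕ} (σ : Term d m), Subterm σ body →
      ∀ H : MRFG S m, Finite H.V → |controller c D σ H| ≤ C := fun σ h => hbound σ (.sup h)
    have hv : ∀ v, |eval body (G.addRoot v) - controller c D body (G.addRoot v)| ≤
        ε * body.slope * j := fun v =>
      ih hb hrank (by omega) (by omega) (G.addRoot v) hG hne (hrich.addRoot v) hclose hhom hdeg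
    have hle : ε * body.slope * j ≤ ε * body.slope * (j + 1 : ℕ) := by
      gcongr
      omega
    rw [eval, controller_sup, Term.slope, iSup]
    refine abs_sSup_sub_le (by positivity) (Set.finite_range _).bddAbove
      (bddAbove_supValues c D hS body G) ?_ ?_
    · rintro _ ⟨v, rfl⟩
      exact ⟨_, Or.inl ⟨v, rfl⟩, (hv v).trans hle⟩
    · rintro _ (⟨v, rfl⟩ | ⟨T, hT, rfl⟩)
      · refine ⟨_, ⟨v, rfl⟩, ?_⟩
        rw [abs_sub_comm]
        exact (hv v).trans hle
      · obtain ⟨v, h⟩ := exists_abs_controller_addRoot_sub_le c D hS hε hη hC (by linarith) hb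
          hrank (by omega) (two_pow_le_radius hj) hG hrich hT
        refine ⟨_, ⟨v, rfl⟩, ?_⟩
        have h' := hv v
        rw [abs_sub_comm] at h'
        refine (abs_sub_le _ _ _).trans ((add_le_add h h').trans (le_of_eq ?_))
        push_cast
        ring

end Main

end AggLogic

theorem mainTheorem4 {d : ℕ} {S : Set (Fin d → ℝ)} (hS : IsCompact S)
    (D : Measure S) [IsProbabilityMeasure D] [D.IsOpenPosMeasure]
    (c : ℝ≥0) (hc : 0 < c)
    (K k₁ k₂ : ℕ) (hK : k₁ + k₂ = K)
    (ε C η : ℝ) (hε : 0 < ε) (hC : 0 < C) (hη : η = ε / (4 * C))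
    {n : ℕ} (hn : n ≤ k₁) (τ : Term d n) (hrank : τ.rank ≤ k₂)
    (hbound : ∀ {m : ℕ} (σ : Term d m), Subterm σ τ →
      ∀ H : MRFG S m, Finite H.V → |controller c D σ H| ≤ C)
    (G : MRFG S n) (hG : Finite G.V)
    (hrich : IsRich k₂ ε η (radius k₂) G)
    (hclose : IsCloseToFBP c D k₂ ε η (radius k₂) G)
    (hhom : IsHomogeneous K η (radius K) G) :
    |eval τ G - controller c D τ G| ≤ ε * (τ.slope : ℝ) * (k₂ : ℝ) := by
  have hη0 : 0 ≤ η := by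
    rw [hη]
    positivity
  have hCη : 4 * (C * η) = ε := by
    rw [hη]
    field_simp
  have hSne : Nonempty S := nonempty_of_isProbabilityMeasure D
  have hne : Nonempty G.V := by
    obtain ⟨P, -, hsnd, -⟩ := hclose
    by_contra hemp
    rw [not_nonempty_iff] at hemp
    let _ : MeasurableSpace G.V := ⊤
    have h0 : P = 0 := Measure.eq_zero_of_isEmpty P
    have h1 := measure_univ (μ := fbpMeasure c D)
    rw [← hsnd, h0, Measure.map_zero] at h1
    simp at h1
  exact abs_eval_sub_controller_le c D hS hε.le hη0 hC.le hCη τ hbound hrank le_rfl (by omega) G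
    hG hne hrich.richAt hclose hhom fun hk =>
      hrich.two_le_maxDeg_or hG hk ((Nat.one_le_two_pow (n := 0)).trans (two_pow_le_radius hk))
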